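/- **Theorem 2.4 (Theorem 0).** Let $I\subseteq\mathbb R$ be an open interval (possibly unbounded), let $a,b,c\in D'(I)$ be complex-valued distributions, and let $\mathcal L u=(au')'+bu'+cu$, with sesquilinear form $$\langle \mathcal L u,v\rangle=-\langle a u',v'\rangle+\langle b u',v\rangle+\langle c u,v\rangle =-\langle a,u'\,\overline{v}'\rangle+\langle b,u'\,\overline v\rangle+\langle c,u\,\overline v\rangle ,\qquad u,v\in C_0^\infty(I)$$ (on the right $\langle\cdot,\cdot\rangle$ is the bilinear pairing of a distribution with a complex test function). The operator $-\mathcal L$ is called accretive if $\mathrm{Re}\,\langle-\mathcal L u,u\rangle\ge 0$ for all complex-valued $u\in C_0^\infty(I)$. Suppose that $p=\mathrm{Re}\,a\in L^1_{\mathrm{loc}}(I)$ and $\mathrm{Im}\,b\in L^1_{\mathrm{loc}}(I)$. Quotients are understood with the conventions $\frac00=0$ and $\frac x0=\infty$ for $x>0$; thus, for $p\ge0$, $\frac{q^2}{p}\in L^1_{\mathrm{loc}}(I)$ includes that $q=0$ a.e. on $\{p=0\}$. An inequality $S\le T$ in $D'(I)$ means $\langle S,\varphi\rangle\le\langle T,\varphi\rangle$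 for all $0\le\varphi\in C_0^\infty(I)$. (i) The operator $-\mathcal L$ is accretive if and only if $p\ge 0$ a.e. on $I$, $\frac{(\mathrm{Im}\,b)^2}{p}\in L^1_{\mathrm{loc}}(I)$, and $$\int_I p\,(h')^2\,dx-\Big\langle \mathrm{Re}\,c-\tfrac12(\mathrm{Re}\,b)',\,h^2\Big\rangle-\int_I\frac{(\mathrm{Im}\,b)^2}{4p}\,h^2\,dx\ge 0$$ for all real-valued $h\in C_0^\infty(I)$. (ii) Suppose that $p\ge0$ a.e. on $I$ and $\frac{(\mathrm{Im}\,b)^2}{p}\in L^1_{\mathrm{loc}}(I)$. If there exists a real-valued function $f\in L^1_{\mathrm{loc}}(I)$ such that $\frac{f^2}{p}\in L^1_{\mathrm{loc}}(I)$ and $$\mathrm{Re}\,c-\tfrac12(\mathrm{Re}\,b)'+\frac{(\mathrm{Im}\,b)^2}{4p}\le f'-\frac{f^2}{p}\quad\text{in } D'(I),\tag{$*$}$$ then $-\mathcal L$ is accretive. Conversely, if $-\mathcal L$ is accretive and $m\le p(x)\le M$ a.e. on $I$ for some constants $m,M>0$, then $\frac{(\mathrm{Im}\,b)^2}{p}\in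 L^1_{\mathrm{loc}}(I)$ and there exists a real-valued function $f\in L^2_{\mathrm{loc}}(I)$, so that $\frac{f^2}{p}\in L^1_{\mathrm{loc}}(I)$, such that $(*)$ holds. -/

import Mathlib

open MeasureTheory TopologicalSpace
open scoped Distributions LineDeriv

namespace Accretive

noncomputable section

/-- The pointwise product of two test functions. -/
def mul {I : Opens ℝ} {A : Type*} [NormedRing A] [NormedAlgebra ℝ A]
    (u v : 𝓓(I, A)) : 𝓓(I, A) where
  toFun x := u x * v x
  contDiff' := u.contDiff.mul v.contDiff
  hasCompactSupport' := u.hasCompactSupport.mul_right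
  tsupport_subset' := (tsupport_mul_subset_left (f := u) (g := v)).trans u.tsupport_subset

@[simp] theorem mul_apply {I : Opens ℝ} {A : Type*} [NormedRing A] [NormedAlgebra ℝ A]
    (u v : 𝓓(I, A)) (x : ℝ) : mul u v x = u x * v x := rfl

/-- The complex conjugate of a complex-valued test function. -/
def conj {I : Opens ℝ} (u : 𝓓(I, ℂ)) : 𝓓(I, ℂ) :=
  TestFunction.postcompCLM (𝕜 := ℝ) (Complex.conjCLE : ℂ →L[ℝ] ℂ) u

/-- The real part of a complex-valued test function. -/
def rePart {I : Opens ℝ} (u : 𝓓(I, ℂ)) : 𝓓(I, ℝ) :=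
  TestFunction.postcompCLM (𝕜 := ℝ) Complex.reCLM u

/-- The imaginary part of a complex-valued test function. -/
def imPart {I : Opens ℝ} (u : 𝓓(I, ℂ)) : 𝓓(I, ℝ) :=
  TestFunction.postcompCLM (𝕜 := ℝ) Complex.imCLM u

/-- The `ℂ`-bilinear pairing of a complex-valued distribution (which in Mathlib acts on
real-valued test functions) with a complex-valued test function. -/
def pair {I : Opens ℝ} (T : 𝓓'(I, ℂ)) (φ : 𝓓(I, ℂ)) : ℂ :=
  T (rePart φ) + Complex.I * T (imPart φ)

/-- The real part of a complex-valued distribution. -/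
def reD {I : Opens ℝ} (T : 𝓓'(I, ℂ)) : 𝓓'(I, ℝ) := Distribution.mapCLM Complex.reCLM T

/-- The imaginary part of a complex-valued distribution. -/
def imD {I : Opens ℝ} (T : 𝓓'(I, ℂ)) : 𝓓'(I, ℝ) := Distribution.mapCLM Complex.imCLM T

/-- The distribution `φ ↦ ∫ g φ` on `I` defined by a function `g ∈ L¹_loc(I)`
(zero when `g` is not locally integrable on `I`). -/
def ofFun (I : Opens ℝ) (g : ℝ → ℝ) : 𝓓'(I, ℝ) :=
  (TestFunction.integralAgainstBilinCLM (ContinuousLinearMap.mul ℝ ℝ) volume g :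
    𝓓(I, ℝ) →L[ℝ] ℝ)

theorem ofFun_apply {I : Opens ℝ} {g : ℝ → ℝ} (hg : LocallyIntegrableOn g I) (φ : 𝓓(I, ℝ)) :
    ofFun I g φ = ∫ x, φ x * g x :=
  TestFunction.integralAgainstBilinCLM_eq_integral hg

/-- The order on real distributions: `S ≤ T` in `D'(I)` means `⟨S, φ⟩ ≤ ⟨T, φ⟩` for every
nonnegative test function `φ`. -/
def DistLE {I : Opens ℝ} (S T : 𝓓'(I, ℝ)) : Prop :=
  ∀ φ : 𝓓(I, ℝ), (∀ x, 0 ≤ φ x) → S φ ≤ T φ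

/-- The sesquilinear form
`⟨ℒ u, v⟩ = -⟨a u', v'⟩ + ⟨b u', v⟩ + ⟨c u, v⟩ = -⟨a, u' v̄'⟩ + ⟨b, u' v̄⟩ + ⟨c, u v̄⟩`
of the operator `ℒ u = (a u')' + b u' + c u` with distributional coefficients. -/
def form {I : Opens ℝ} (a b c : 𝓓'(I, ℂ)) (u v : 𝓓(I, ℂ)) : ℂ :=
  -pair a (mul (∂_{(1 : ℝ)} u) (conj (∂_{(1 : ℝ)} v)))
    + pair b (mul (∂_{(1 : ℝ)} u) (conj v)) + pair c (mul u (conj v))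

/-- `-ℒ` is accretive: `Re ⟨-ℒ u, u⟩ ≥ 0` for all complex-valued `u ∈ C₀^∞(I)`. -/
def IsAccretive {I : Opens ℝ} (a b c : 𝓓'(I, ℂ)) : Prop :=
  ∀ u : 𝓓(I, ℂ), 0 ≤ (-form a b c u u).re

/-- `q² / p ∈ L¹_loc(I)` for `p ≥ 0`, with the conventions `0 / 0 = 0` and `x / 0 = ∞` for `x > 0`:
the second one forces `q = 0` almost everywhere on `{p = 0}`. -/
def SqDivLocInt (I : Opens ℝ) (q p : ℝ → ℝ) : Prop :=
  (∀ᵐ x ∂volume.restrict (I : Set ℝ), p x = 0 → q x = 0) ∧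
    LocallyIntegrableOn (fun x => q x ^ 2 / p x) I

/-- `f ∈ L²_loc(I)`. -/
def LocL2 (I : Opens ℝ) (f : ℝ → ℝ) : Prop :=
  ∀ K : Set ℝ, IsCompact K → K ⊆ I → MemLp f 2 (volume.restrict K)

/-- The real distribution `σ = Re c - ½ (Re b)'`. -/
def sigma {I : Opens ℝ} (b c : 𝓓'(I, ℂ)) : 𝓓'(I, ℝ) :=
  reD c - (1 / 2 : ℝ) • ∂_{(1 : ℝ)} (reD b)

/-- The Riccati inequality
`Re c - ½ (Re b)' + β² / (4 p) ≤ f' - f² / p` in `D'(I)`, used when `β² / p`, `f` and `f² / p` are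
locally integrable on `I`. -/
def RiccatiLE {I : Opens ℝ} (b c : 𝓓'(I, ℂ)) (p β f : ℝ → ℝ) : Prop :=
  DistLE (sigma b c + ofFun I (fun x => β x ^ 2 / (4 * p x)))
    (∂_{(1 : ℝ)} (ofFun I f) - ofFun I (fun x => f x ^ 2 / p x))

end

end Accretive

/-!
For `p = Re a`, `β = Im b` and `σ = Re c - ½ (Re b)'` the form of `-ℒ` is
`Q(u) = ∫ p |u'|² - ⟨σ, |u|²⟩ + ∫ β Im (u' ū)` (`re_neg_form`).

*The criterion.* For `u = h e^{iθ}` one finds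
`Q(u) = ∫ p h'² - ⟨σ, h²⟩ + ∫ (p φ² + β φ) h²` with `φ = θ'`. By mollification `φ` may be any
bounded measurable function, and minimising over `φ` pointwise gives `p ≥ 0`, the integrability
of `β² / p` and the inequality of the criterion (`sq_div_of_forall_contDiff`, `criterion_of_accretive`).
Conversely, `Q(u)` is bounded below by the expression of the criterion at `h = |u|` whenever `|u|`
is smooth. In general one perturbs `u` to `u + w χ`, where `χ` is a cutoff equal to `1` near the
support of `u` and `-w` is not a value of `u`. Then `|u + w χ|` is smooth, and `w` can be taken
arbitrarily small because a smooth curve in the plane has dense complement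
(`accretive_of_criterion`).

*Riccati implies accretive.* Testing the inequality on `h²`, one completes the square
(`criterion_of_riccati`).

*Accretive implies Riccati.* Put `τ = σ + β² / (4 p)`, so that `τ(h²) ≤ ∫ p h'²` for all real test
functions `h`. Wanted is an `f` such that `τ(φ) ≤ -∫ f φ' - ∫ f² φ / p` for all `φ ≥ 0`. As
`-f² / p` is the minimum of `p ψ² - 2 f ψ` over `ψ`, this is the family of *linear*
conditions `∫ f (φ' + 2 ψ φ) ≤ ∫ p ψ² φ - τ(φ)` over all `φ ≥ 0` and `ψ`. The pairs of
`ξ = φ' + 2 ψ φ` and numbers above the right-hand side form a convex cone, so by the Riesz extension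
theorem a linear functional `Λ` satisfying these conditions exists as soon as the right-hand side is
nonnegative for `ξ = 0`. That is `τ(φ) ≤ ∫ p φ'² / (4 φ) = ∫ p ((√φ)')²`, the hypothesis for
`h = √φ`, made rigorous with `√(φ + ε χ²)` (`le_energy`, `exists_functional`). Taking `φ = χ²` with
`χ = 1` on a compact set shows that `Λ` is bounded on the square integrable functions supported
there, hence is given locally, and then globally, by a function `f ∈ L²_loc`
(`exists_global_representative`, `exists_riccati`).
-/

namespace Accretive

section

open Filter Topology Set

variable {I : Opens ℝ}

/-! ### Test functions and the quadratic form -/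

theorem lineDeriv_one_apply {F : Type*} [NormedAddCommGroup F] [NormedSpace ℝ F]
    (u : 𝓓(I, F)) (x : ℝ) : (∂_{(1 : ℝ)} u) x = deriv u x := by
  rw [TestFunction.lineDerivOp_eq_lineDerivCLM (𝕜 := ℝ),
    TestFunction.lineDerivCLM_apply_of_le (by simp),
    ((u.contDiff.differentiable (by simp)).differentiableAt).lineDeriv_eq_fderiv,
    fderiv_apply_one_eq_deriv]

theorem hasDerivAt_test {F : Type*} [NormedAddCommGroup F] [NormedSpace ℝ F]
    (u : 𝓓(I, F)) (x : ℝ) : HasDerivAt u ((∂_{(1 : ℝ)} u) x) x := by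
  rw [lineDeriv_one_apply]
  exact ((u.contDiff.differentiable (by simp)).differentiableAt).hasDerivAt

theorem exists_cutoff {K : Set ℝ} (hK : IsCompact K) (hKI : K ⊆ I) :
    ∃ χ : 𝓓(I, ℝ), (∀ x, 0 ≤ χ x) ∧ ∀ x ∈ K, ∀ᶠ y in 𝓝 x, χ y = 1 := by
  obtain ⟨L, hL, hKL, hLI⟩ := exists_compact_between hK I.isOpen hKI
  obtain ⟨f, hf1, hf0, hf⟩ := exists_contMDiffMap_one_nhds_of_subset_interior (n := (⊤ : ℕ∞))
    (modelWithCornersSelf ℝ ℝ) hK.isClosed hKL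
  have hts : tsupport f ⊆ L := closure_minimal (fun x hx => by
    by_contra h; exact hx (hf0 x h)) hL.isClosed
  refine ⟨⟨f, f.contMDiff.contDiff, HasCompactSupport.intro hL hf0, hts.trans hLI⟩,
    fun x => (hf x).1, fun x hx => ?_⟩
  exact (eventually_nhdsSet_iff_forall.1 hf1) x hx

/-- A nonnegative test function which near each point is either positive or the square of a
nonnegative smooth function is the square of a nonnegative test function. It is applied to
`φ + ε χ²` and `|u + w χ|²`, where `χ` is a cutoff equal to `1` near the support of `φ` or `u`. -/
theorem exists_sq_eq (g : 𝓓(I, ℝ)) (hg : ∀ x, 0 < g x ∨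
    ∃ k : ℝ → ℝ, ContDiffAt ℝ ((⊤ : ℕ∞) : WithTop ℕ∞) k x ∧ ∀ᶠ y in 𝓝 x, 0 ≤ k y ∧ g y = k y ^ 2) :
    ∃ h : 𝓓(I, ℝ), ∀ x, 0 ≤ h x ∧ h x ^ 2 = g x := by
  have hg0 : ∀ x, 0 ≤ g x := fun x => by
    rcases hg x with h | ⟨k, -, hk⟩
    · exact h.le
    · rw [hk.self_of_nhds.2]; positivity
  have hsupp : Function.support (fun x => √(g x)) ⊆ Function.support g := fun x hx h => by
    simp [h] at hx
  refine ⟨⟨fun x => √(g x), contDiff_iff_contDiffAt.2 fun x => ?_,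
    g.hasCompactSupport.mono hsupp, (closure_mono hsupp).trans g.tsupport_subset⟩,
    fun x => ⟨Real.sqrt_nonneg _, Real.sq_sqrt (hg0 x)⟩⟩
  rcases hg x with h | ⟨k, hk, hgk⟩
  · exact g.contDiff.contDiffAt.sqrt h.ne'
  · refine hk.congr_of_eventuallyEq ?_
    filter_upwards [hgk] with y hy
    rw [hy.2, Real.sqrt_sq hy.1]

theorem integrable_mul_of_bdd {g ζ : ℝ → ℝ} (hg : LocallyIntegrableOn g I)
    (hζ : AEStronglyMeasurable ζ) {C : ℝ} (hC : ∀ x, |ζ x| ≤ C) {K : Set ℝ} (hK : IsCompact K)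
    (hKI : K ⊆ I) (h0 : ∀ x ∉ K, ζ x = 0) : Integrable (fun x => ζ x * g x) := by
  have h1 : IntegrableOn (fun x => ζ x * g x) K :=
    (hg.integrableOn_compact_subset hKI hK).bdd_mul (c := C) hζ.restrict (ae_of_all _ hC)
  rwa [integrableOn_iff_integrable_of_support_subset] at h1
  intro x hx
  by_contra h
  exact hx (by simp [h0 x h])

theorem integrable_mul_of_continuous {g ζ : ℝ → ℝ} (hg : LocallyIntegrableOn g I)
    (hζ : Continuous ζ) {K : Set ℝ} (hK : IsCompact K)
    (hKI : K ⊆ I) (h0 : ∀ x ∉ K, ζ x = 0) : Integrable (fun x => ζ x * g x) := by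
  obtain ⟨C, hC⟩ := hζ.bounded_above_of_compact_support (HasCompactSupport.intro hK h0)
  exact integrable_mul_of_bdd hg hζ.aestronglyMeasurable hC hK hKI h0

theorem integrable_test_mul {g : ℝ → ℝ} (hg : LocallyIntegrableOn g I) (φ : 𝓓(I, ℝ)) :
    Integrable (fun x => φ x * g x) :=
  integrable_mul_of_continuous hg φ.continuous φ.hasCompactSupport φ.tsupport_subset
    (fun _ => image_eq_zero_of_notMem_tsupport)

/-- The test function `|u|²`. -/
noncomputable def normSqT (u : 𝓓(I, ℂ)) : 𝓓(I, ℝ) := rePart (mul u (conj u))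

@[simp] theorem rePart_apply (u : 𝓓(I, ℂ)) (x : ℝ) : rePart u x = (u x).re := rfl

@[simp] theorem imPart_apply (u : 𝓓(I, ℂ)) (x : ℝ) : imPart u x = (u x).im := rfl

@[simp] theorem conj_apply (u : 𝓓(I, ℂ)) (x : ℝ) : conj u x = (starRingEnd ℂ) (u x) := rfl

@[simp] theorem normSqT_apply (u : 𝓓(I, ℂ)) (x : ℝ) : normSqT u x = Complex.normSq (u x) := by
  simp [normSqT, Complex.normSq_apply]

theorem pair_re (T : 𝓓'(I, ℂ)) (φ : 𝓓(I, ℂ)) :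
    (pair T φ).re = reD T (rePart φ) - imD T (imPart φ) := by
  simp [pair, reD, imD, sub_eq_add_neg]

/-- Since `|u|²` is real, only the real part of a distribution `T` enters `Re ⟨T, |u|²⟩`. -/
theorem pair_re_mul_conj (T : 𝓓'(I, ℂ)) (u : 𝓓(I, ℂ)) :
    (pair T (mul u (conj u))).re = reD T (normSqT u) := by
  have : imPart (mul u (conj u)) = 0 := by
    ext x; simp [mul_comm]
  rw [pair_re, this, map_zero, sub_zero]; rfl

/-- `Re (u' ū) = ½ (|u|²)'`, which moves the real part of `b` into `σ = Re c - ½ (Re b)'`. -/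
theorem rePart_mul_conj_deriv (u : 𝓓(I, ℂ)) :
    rePart (mul (∂_{(1 : ℝ)} u) (conj u)) = (1 / 2 : ℝ) • ∂_{(1 : ℝ)} (normSqT u) := by
  ext x
  have h1 := hasDerivAt_test u x
  have h2 : HasDerivAt (fun x => Complex.normSq (u x))
      (2 * (((∂_{(1 : ℝ)} u) x) * (starRingEnd ℂ) (u x)).re) x := by
    have hre : HasDerivAt (fun y => (u y).re) ((∂_{(1 : ℝ)} u) x).re x :=
      (Complex.reCLM.hasFDerivAt.comp_hasDerivAt x h1)
    have him : HasDerivAt (fun y => (u y).im) ((∂_{(1 : ℝ)} u) x).im x :=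
      (Complex.imCLM.hasFDerivAt.comp_hasDerivAt x h1)
    refine (((hre.mul hre).add (him.mul him)).congr_of_eventuallyEq
      (Eventually.of_forall fun y => Complex.normSq_apply _)).congr_deriv ?_
    rw [Complex.mul_re, Complex.conj_re, Complex.conj_im]
    ring
  have h3 := (hasDerivAt_test (normSqT u) x).unique (by simpa [funext (normSqT_apply u)] using h2)
  simp [h3]

/-- The quadratic form of `-ℒ`: only `p`, `σ` and `β = Im b` enter, and `β` sees the rotation
`Im (u' ū)` of `u`. -/
theorem re_neg_form {a b c : 𝓓'(I, ℂ)} {p β : ℝ → ℝ}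
    (hp : LocallyIntegrableOn p I) (hpa : reD a = ofFun I p)
    (hβ : LocallyIntegrableOn β I) (hβb : imD b = ofFun I β) (u : 𝓓(I, ℂ)) :
    (-form a b c u u).re = (∫ x, p x * Complex.normSq (deriv u x)) - sigma b c (normSqT u)
      + ∫ x, β x * (deriv u x * (starRingEnd ℂ) (u x)).im := by
  have h1 : (pair a (mul (∂_{(1 : ℝ)} u) (conj (∂_{(1 : ℝ)} u)))).re
      = ∫ x, p x * Complex.normSq (deriv u x) := by
    rw [pair_re_mul_conj, hpa, ofFun_apply hp]
    simp [mul_comm, lineDeriv_one_apply]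
  have h2 : (pair b (mul (∂_{(1 : ℝ)} u) (conj u))).re
      = reD b ((1 / 2 : ℝ) • ∂_{(1 : ℝ)} (normSqT u))
        - ∫ x, β x * (deriv u x * (starRingEnd ℂ) (u x)).im := by
    rw [pair_re, hβb, ofFun_apply hβ, rePart_mul_conj_deriv]
    congr 2
    ext x
    rw [imPart_apply, mul_apply, conj_apply, lineDeriv_one_apply, mul_comm]
  have h3 : sigma b c (normSqT u) = reD c (normSqT u)
      + reD b ((1 / 2 : ℝ) • ∂_{(1 : ℝ)} (normSqT u)) := by
    simp only [sigma, map_smul]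
    simp [Distribution.lineDerivOp_apply_apply]
  simp only [form, Complex.neg_re, Complex.add_re, h1, h2, pair_re_mul_conj c, h3]
  ring

/-! ### Accretivity implies the criterion -/

/-- Accretivity tested on `u = h e^{iθ}` with `θ' = φ`, for which `|u|² = h²`,
`|u'|² = h'² + h² φ²` and `Im (u' ū) = h² φ`. -/
theorem accretive_polar {a b c : 𝓓'(I, ℂ)} {p β : ℝ → ℝ}
    (hp : LocallyIntegrableOn p I) (hpa : reD a = ofFun I p)
    (hβ : LocallyIntegrableOn β I) (hβb : imD b = ofFun I β) (hacc : IsAccretive a b c)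
    (h : 𝓓(I, ℝ)) {φ : ℝ → ℝ} (hφ : ContDiff ℝ ((⊤ : ℕ∞) : WithTop ℕ∞) φ) :
    0 ≤ (∫ x, p x * deriv h x ^ 2) - sigma b c (mul h h)
      + ∫ x, (p x * h x ^ 2) * φ x ^ 2 + (β x * h x ^ 2) * φ x := by
  have hθd : ∀ x, HasDerivAt (fun x => ∫ t in (0 : ℝ)..x, φ t) (φ x) x := fun x =>
    (hφ.continuous.integral_hasStrictDerivAt 0 x).hasDerivAt
  obtain ⟨θ, hθd⟩ : ∃ θ : ℝ → ℝ, ∀ x, HasDerivAt θ (φ x) x := ⟨_, hθd⟩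
  have hθ : ContDiff ℝ ((⊤ : ℕ∞) : WithTop ℕ∞) θ := by
    refine contDiff_infty_iff_deriv.2 ⟨fun x => (hθd x).differentiableAt, ?_⟩
    rwa [show deriv θ = φ from funext fun x => (hθd x).deriv]
  have hsm : ContDiff ℝ ((⊤ : ℕ∞) : WithTop ℕ∞)
      (fun x => (h x : ℂ) * Complex.exp ((θ x : ℂ) * Complex.I)) :=
    (Complex.ofRealCLM.contDiff.comp h.contDiff).mul
      (((Complex.ofRealCLM.contDiff.comp hθ).mul contDiff_const).cexp)
  have hsupp : Function.support (fun x => (h x : ℂ) * Complex.exp ((θ x : ℂ) * Complex.I))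
      ⊆ Function.support h := fun x hx hx0 => hx (by simp [hx0])
  let u : 𝓓(I, ℂ) := ⟨_, hsm, h.hasCompactSupport.mono hsupp,
    (closure_mono hsupp).trans h.tsupport_subset⟩
  have hu : ∀ x, u x = (h x : ℂ) * Complex.exp ((θ x : ℂ) * Complex.I) := fun _ => rfl
  have hE : ∀ x, Complex.normSq (Complex.exp ((θ x : ℂ) * Complex.I)) = 1 := fun x => by
    rw [Complex.normSq_eq_norm_sq, Complex.norm_exp_ofReal_mul_I, one_pow]
  have hu' : ∀ x, deriv u x = (((deriv h x : ℝ) : ℂ) + ((h x * φ x : ℝ) : ℂ) * Complex.I)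
      * Complex.exp ((θ x : ℂ) * Complex.I) := fun x => by
    have h1 : HasDerivAt h (deriv h x) x := by
      simpa [lineDeriv_one_apply] using hasDerivAt_test h x
    refine HasDerivAt.deriv (((h1.ofReal_comp).mul
      (((hθd x).ofReal_comp.mul_const Complex.I).cexp)).congr_deriv ?_)
    push_cast
    ring
  have key := hacc u
  rw [re_neg_form hp hpa hβ hβb] at key
  have e1 : normSqT u = mul h h := by
    ext x
    rw [normSqT_apply, hu, Complex.normSq_mul, hE, mul_apply, Complex.normSq_ofReal, mul_one]
  have e2 : ∀ x, p x * Complex.normSq (deriv u x) =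
      deriv h x ^ 2 * p x + h x ^ 2 * φ x ^ 2 * p x := fun x => by
    rw [hu', Complex.normSq_mul, hE, Complex.normSq_add_mul_I]
    ring
  have e3 : ∀ x, β x * (deriv u x * (starRingEnd ℂ) (u x)).im = h x ^ 2 * φ x * β x := fun x => by
    rw [hu', hu, map_mul, mul_mul_mul_comm, Complex.mul_conj, hE, Complex.conj_ofReal]
    simp
    ring
  have z : ∀ x ∉ tsupport h, h x = 0 := fun x => image_eq_zero_of_notMem_tsupport
  have z' : ∀ x ∉ tsupport h, deriv h x = 0 := fun x hx => by
    by_contra h'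
    exact hx (support_deriv_subset h')
  have hd : Continuous (deriv h) := h.contDiff.continuous_deriv (by simp)
  have i1 := integrable_mul_of_continuous (ζ := fun x => deriv h x ^ 2) hp (hd.pow 2)
    h.hasCompactSupport h.tsupport_subset (fun x hx => by simp [z' x hx])
  have i2 := integrable_mul_of_continuous (ζ := fun x => h x ^ 2 * φ x ^ 2) hp
    ((h.continuous.pow 2).mul (hφ.continuous.pow 2))
    h.hasCompactSupport h.tsupport_subset (fun x hx => by simp [z x hx])
  have i3 := integrable_mul_of_continuous (ζ := fun x => h x ^ 2 * φ x) hβ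
    ((h.continuous.pow 2).mul hφ.continuous)
    h.hasCompactSupport h.tsupport_subset (fun x hx => by simp [z x hx])
  rw [e1, integral_congr_ae (ae_of_all _ e2), integral_congr_ae (ae_of_all _ e3),
    integral_add i1 i2] at key
  have e4 : ∫ x, (p x * h x ^ 2) * φ x ^ 2 + (β x * h x ^ 2) * φ x =
      (∫ x, h x ^ 2 * φ x ^ 2 * p x) + ∫ x, h x ^ 2 * φ x * β x := by
    rw [← integral_add i2 i3]
    congr 1; ext x; ring
  rw [e4]
  have e5 : ∫ x, p x * deriv h x ^ 2 = ∫ x, deriv h x ^ 2 * p x := by simp_rw [mul_comm]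
  rw [e5]
  linarith

/-- By mollification, an integral inequality known for all smooth `φ` holds for all bounded
measurable `φ`: the mollified functions are uniformly bounded and converge almost everywhere. -/
theorem nonneg_of_forall_contDiff {P B : ℝ → ℝ} (hP : Integrable P) (hB : Integrable B) {C₀ : ℝ}
    (H : ∀ φ : ℝ → ℝ, ContDiff ℝ ((⊤ : ℕ∞) : WithTop ℕ∞) φ →
      0 ≤ C₀ + ∫ x, P x * φ x ^ 2 + B x * φ x)
    {φ : ℝ → ℝ} (hφ : Measurable φ) {C : ℝ} (hC : ∀ x, |φ x| ≤ C) :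
    0 ≤ C₀ + ∫ x, P x * φ x ^ 2 + B x * φ x := by
  have hC0 : 0 ≤ C := (abs_nonneg _).trans (hC 0)
  have hφl : LocallyIntegrable φ := by
    refine (locallyIntegrable_const C).mono hφ.aestronglyMeasurable (ae_of_all _ fun x => ?_)
    rw [Real.norm_eq_abs, Real.norm_eq_abs, abs_of_nonneg hC0]
    exact hC x
  let w : ℕ → ContDiffBump (0 : ℝ) := fun n =>
    ⟨1 / ((n : ℝ) + 1), 2 * (1 / ((n : ℝ) + 1)), by positivity, by
      have : 0 < 1 / ((n : ℝ) + 1) := by positivity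
      linarith⟩
  have hw : Tendsto (fun n => (w n).rOut) atTop (𝓝 0) := by
    have := (tendsto_one_div_add_atTop_nhds_zero_nat (𝕜 := ℝ)).const_mul 2
    rwa [mul_zero] at this
  let ψ : ℕ → ℝ → ℝ := fun n =>
    (MeasureTheory.convolution ((w n).normed volume) φ (ContinuousLinearMap.lsmul ℝ ℝ) volume)
  have hψlim : ∀ᵐ x, Tendsto (fun n => ψ n x) atTop (𝓝 (φ x)) :=
    ContDiffBump.ae_convolution_tendsto_right_of_locallyIntegrable (K := 2) hw
      (Eventually.of_forall fun n => le_rfl) hφl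
  have hψs : ∀ n, ContDiff ℝ ((⊤ : ℕ∞) : WithTop ℕ∞) (ψ n) := fun n =>
    (w n).hasCompactSupport_normed.contDiff_convolution_left _ (w n).contDiff_normed hφl
  have hψC : ∀ n x, |ψ n x| ≤ C := fun n x => by
    have h1 : ‖∫ t, (w n).normed volume t * φ (x - t)‖ ≤ ∫ t, (w n).normed volume t * C := by
      refine norm_integral_le_of_norm_le ((w n).integrable_normed.mul_const C)
        (ae_of_all _ fun t => ?_)
      rw [norm_mul, Real.norm_eq_abs, Real.norm_eq_abs, abs_of_nonneg ((w n).nonneg_normed t)]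
      exact mul_le_mul_of_nonneg_left (hC _) ((w n).nonneg_normed t)
    rw [integral_mul_const, (w n).integral_normed, one_mul] at h1
    exact h1
  have hlim : Tendsto (fun n => ∫ x, P x * ψ n x ^ 2 + B x * ψ n x) atTop
      (𝓝 (∫ x, P x * φ x ^ 2 + B x * φ x)) := by
    refine tendsto_integral_of_dominated_convergence (fun x => ‖P x‖ * C ^ 2 + ‖B x‖ * C)
      (fun n => ?_) ((hP.norm.mul_const _).add (hB.norm.mul_const _))
      (fun n => ae_of_all _ fun x => ?_) ?_
    · have := (hψs n).continuous.aestronglyMeasurable (μ := volume)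
      exact (hP.1.mul (this.pow 2)).add (hB.1.mul this)
    · refine (norm_add_le _ _).trans (add_le_add ?_ ?_)
      · rw [norm_mul, norm_pow]
        exact mul_le_mul_of_nonneg_left (pow_le_pow_left₀ (norm_nonneg _) (hψC n x) 2)
          (norm_nonneg _)
      · rw [norm_mul]
        exact mul_le_mul_of_nonneg_left (hψC n x) (norm_nonneg _)
    · filter_upwards [hψlim] with x hx
      exact ((hx.pow 2).const_mul _).add (hx.const_mul _)
  exact ge_of_tendsto' (hlim.const_add C₀) fun n => H _ (hψs n)

/-- If `∫ (P φ² + B φ) ≥ -C₀` for all bounded measurable `φ`, then `P ≥ 0`, `B = 0` where `P = 0`,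
and `∫ B² / (4 P) ≤ C₀`. The integrand has pointwise minimum `-B² / (4 P)`, attained at
`φ = -B / (2 P)`. -/
theorem sq_div_of_forall_measurable {P B : ℝ → ℝ} (hPm : Measurable P) (hBm : Measurable B)
    (hP : Integrable P) (hB : Integrable B) {C₀ : ℝ}
    (H : ∀ φ : ℝ → ℝ, Measurable φ → (∃ C, ∀ x, |φ x| ≤ C) →
      0 ≤ C₀ + ∫ x, P x * φ x ^ 2 + B x * φ x) :
    (∀ᵐ x, 0 ≤ P x) ∧ (∀ᵐ x, P x = 0 → B x = 0) ∧ Integrable (fun x => B x ^ 2 / (4 * P x)) ∧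
      ∫ x, B x ^ 2 / (4 * P x) ≤ C₀ := by
  -- `φ = l · 1_{P < 0}` gives a quadratic polynomial in `l` bounded below
  have hneg : ∀ᵐ x, 0 ≤ P x := by
    have hS : MeasurableSet {x | P x < 0} := measurableSet_lt hPm measurable_const
    set S := {x | P x < 0}
    have h1 : ∀ l : ℝ, 0 ≤ C₀ + (l ^ 2 * ∫ x, S.indicator P x) + l * ∫ x, S.indicator B x := by
      intro l
      have := H (S.indicator fun _ => l) (measurable_const.indicator hS) ⟨|l|, fun x => by
        by_cases hx : x ∈ S <;> simp [hx]⟩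
      have e : ∀ x, P x * (S.indicator (fun _ => l) x) ^ 2 + B x * (S.indicator (fun _ => l) x)
          = l ^ 2 * S.indicator P x + l * S.indicator B x := fun x => by
        by_cases hx : x ∈ S <;> simp [hx]; ring
      rw [integral_congr_ae (ae_of_all _ e), integral_add ((hP.indicator hS).const_mul _)
        ((hB.indicator hS).const_mul _), integral_const_mul, integral_const_mul] at this
      linarith
    have h2 : 0 ≤ ∫ x, S.indicator P x := by
      by_contra! hlt
      set A := ∫ x, S.indicator P x
      set D := ∫ x, S.indicator B x
      have h3 := h1 ((|C₀| + |D| + 1) / (-A) + 1)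
      set l := (|C₀| + |D| + 1) / (-A) + 1 with hl
      have hl1 : 1 ≤ l := by
        have : 0 ≤ (|C₀| + |D| + 1) / (-A) := by
          apply div_nonneg <;> [positivity; linarith]
        linarith
      have hlA : l * (-A) = |C₀| + |D| + 1 + (-A) := by
        rw [hl, add_mul, div_mul_cancel₀ _ (by linarith), one_mul]
      nlinarith [le_abs_self C₀, le_abs_self D, abs_nonneg C₀, abs_nonneg D]
    have h4 : ∀ x, 0 ≤ -S.indicator P x := fun x => by
      by_cases hx : x ∈ S
      · simp only [hx, indicator_of_mem]; have : P x < 0 := hx; linarith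
      · simp [hx]
    have h5 : ∫ x, -S.indicator P x = 0 := by
      refine le_antisymm ?_ (integral_nonneg h4)
      rw [integral_neg]; linarith
    have h6 := (integral_eq_zero_iff_of_nonneg h4 (hP.indicator hS).neg).1 h5
    filter_upwards [h6] with x hx
    by_contra! hlt
    have : x ∈ S := hlt
    simp [this] at hx
    linarith
  -- `φ = -l sign B · 1_{P = 0}` gives an affine function of `l` bounded below
  have hzero : ∀ᵐ x, P x = 0 → B x = 0 := by
    have hS : MeasurableSet {x | P x = 0} := hPm (measurableSet_singleton 0)
    set S := {x | P x = 0}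
    have h1 : ∀ l : ℝ, 0 ≤ C₀ - l * ∫ x, S.indicator (fun x => |B x|) x := by
      intro l
      have hm : Measurable (fun x => -l * Real.sign (B x)) := by
        refine measurable_const.mul ?_
        unfold Real.sign
        exact Measurable.ite (measurableSet_lt hBm measurable_const) measurable_const
          (Measurable.ite (measurableSet_lt measurable_const hBm) measurable_const measurable_const)
      have := H (S.indicator fun x => -l * Real.sign (B x)) (hm.indicator hS) ⟨|l|, fun x => by
        by_cases hx : x ∈ S
        · rw [indicator_of_mem hx, abs_mul, abs_neg]
          refine mul_le_of_le_one_right (abs_nonneg _) ?_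
          rcases Real.sign_apply_eq (B x) with h | h | h <;> simp [h]
        · simp [hx]⟩
      have e : ∀ x, P x * (S.indicator (fun x => -l * Real.sign (B x)) x) ^ 2
          + B x * (S.indicator (fun x => -l * Real.sign (B x)) x)
          = -l * S.indicator (fun x => |B x|) x := fun x => by
        by_cases hx : x ∈ S
        · have hx0 : P x = 0 := hx
          simp only [hx, indicator_of_mem, hx0, zero_mul, zero_add]
          have : |B x| = B x * Real.sign (B x) := by
            rcases lt_trichotomy (B x) 0 with h | h | h
            · rw [Real.sign_of_neg h, abs_of_neg h]; ring
            · simp [h]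
            · rw [Real.sign_of_pos h, abs_of_pos h]; ring
          rw [this]; ring
        · simp [hx]
      rw [integral_congr_ae (ae_of_all _ e), integral_const_mul] at this
      linarith
    have h4 : ∀ x, 0 ≤ S.indicator (fun x => |B x|) x :=
      indicator_nonneg fun x _ => abs_nonneg _
    have h5 : ∫ x, S.indicator (fun x => |B x|) x = 0 := by
      refine le_antisymm ?_ (integral_nonneg h4)
      by_contra! hlt
      have := h1 ((C₀ + 1) / ∫ x, S.indicator (fun x => |B x|) x)
      rw [div_mul_cancel₀ _ hlt.ne'] at this
      linarith
    have h6 := (integral_eq_zero_iff_of_nonneg h4 (hB.abs.indicator hS)).1 h5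
    filter_upwards [h6] with x hx hx0
    have : x ∈ S := hx0
    simpa [this] using hx
  have hm : Measurable (fun x => B x ^ 2 / (4 * P x)) := (hBm.pow_const 2).div (hPm.const_mul 4)
  -- The minimiser `-B / (2 P)` is bounded on `S n`; the sets `S n` exhaust `ℝ` up to a null set.
  let S : ℕ → Set ℝ := fun n => {x | |B x| ≤ n * P x}
  have hS : ∀ n, MeasurableSet (S n) := fun n =>
    measurableSet_le hBm.abs (hPm.const_mul _)
  have hbd : ∀ n x, x ∈ S n → |-(B x / (2 * P x))| ≤ n := fun n x hx => by
    have hx' : |B x| ≤ n * P x := hx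
    have hnP : 0 ≤ (n : ℝ) * P x := (abs_nonneg _).trans hx'
    rcases lt_trichotomy (P x) 0 with h | h | h
    · have hn : (n : ℝ) = 0 := by
        by_contra hne
        have : 0 < (n : ℝ) := lt_of_le_of_ne (Nat.cast_nonneg n) (Ne.symm hne)
        nlinarith
      have : B x = 0 := by simpa [hn] using hx'
      simp [this]
    · simp [h]
    · rw [abs_neg, abs_div, abs_of_pos (by positivity : 0 < 2 * P x), div_le_iff₀ (by positivity)]
      nlinarith
  have hint : ∀ n, Integrable ((S n).indicator fun x => B x ^ 2 / (4 * P x)) := fun n => by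
    refine (hB.norm.mul_const (n : ℝ)).mono' (hm.indicator (hS n)).aestronglyMeasurable ?_
    filter_upwards [hneg] with x hP0
    by_cases hx : x ∈ S n
    · rw [indicator_of_mem hx]
      have h1 := hbd n x hx
      have e : B x ^ 2 / (4 * P x) = (-1 / 2 * B x) * (-(B x / (2 * P x))) := by
        rcases eq_or_ne (P x) 0 with h | h
        · simp [h]
        · field_simp; ring
      rw [e, norm_mul, Real.norm_eq_abs (-(B x / (2 * P x)))]
      refine mul_le_mul ?_ h1 (abs_nonneg _) (norm_nonneg _)
      rw [norm_mul]
      norm_num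
      linarith [abs_nonneg (B x)]
    · rw [indicator_of_notMem hx, norm_zero]; positivity
  have hle : ∀ n, ∫ x, (S n).indicator (fun x => B x ^ 2 / (4 * P x)) x ≤ C₀ := fun n => by
    have := H ((S n).indicator fun x => -(B x / (2 * P x)))
      ((hBm.div (hPm.const_mul 2)).neg.indicator (hS n)) ⟨n, fun x => by
        by_cases hx : x ∈ S n
        · rw [indicator_of_mem hx]; exact hbd n x hx
        · simp [hx]⟩
    have e : ∀ x, P x * ((S n).indicator (fun x => -(B x / (2 * P x))) x) ^ 2
        + B x * ((S n).indicator (fun x => -(B x / (2 * P x))) x)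
        = -(S n).indicator (fun x => B x ^ 2 / (4 * P x)) x := fun x => by
      by_cases hx : x ∈ S n
      · simp only [hx, indicator_of_mem]
        rcases eq_or_ne (P x) 0 with h | h
        · simp [h]
        · field_simp; ring
      · simp [hx]
    rw [integral_congr_ae (ae_of_all _ e), integral_neg] at this
    linarith
  have hC₀ : 0 ≤ C₀ := by simpa using H (fun _ => 0) measurable_const ⟨0, by simp⟩
  have hpos : ∀ᵐ x, 0 ≤ B x ^ 2 / (4 * P x) := by
    filter_upwards [hneg] with x hx; positivity
  have hlint : ∫⁻ x, ENNReal.ofReal (B x ^ 2 / (4 * P x)) ≤ ENNReal.ofReal C₀ := by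
    have hlim : ∀ᵐ x, Tendsto (fun n => ENNReal.ofReal ((S n).indicator
        (fun x => B x ^ 2 / (4 * P x)) x)) atTop (𝓝 (ENNReal.ofReal (B x ^ 2 / (4 * P x)))) := by
      filter_upwards [hneg, hzero] with x h1 h2
      obtain ⟨N, hN⟩ : ∃ N : ℕ, |B x| ≤ N * P x := by
        rcases h1.eq_or_lt with h | h
        · exact ⟨0, by simp [h2 h.symm]⟩
        · obtain ⟨N, hN⟩ := exists_nat_ge (|B x| / P x)
          exact ⟨N, (div_le_iff₀ h).1 hN⟩
      refine tendsto_const_nhds.congr' ?_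
      filter_upwards [eventually_ge_atTop N] with n hn
      have : x ∈ S n := hN.trans (mul_le_mul_of_nonneg_right (by exact_mod_cast hn) h1)
      rw [indicator_of_mem this]
    calc ∫⁻ x, ENNReal.ofReal (B x ^ 2 / (4 * P x))
        = ∫⁻ x, liminf (fun n => ENNReal.ofReal ((S n).indicator
            (fun x => B x ^ 2 / (4 * P x)) x)) atTop :=
          lintegral_congr_ae (by filter_upwards [hlim] with x hx; exact hx.liminf_eq.symm)
      _ ≤ liminf (fun n => ∫⁻ x, ENNReal.ofReal ((S n).indicator
            (fun x => B x ^ 2 / (4 * P x)) x)) atTop :=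
          lintegral_liminf_le fun n => (hm.indicator (hS n)).ennreal_ofReal
      _ ≤ ENNReal.ofReal C₀ := by
          refine liminf_le_of_le (by isBoundedDefault) fun b hb => ?_
          obtain ⟨n, hn⟩ := hb.exists
          refine hn.trans ?_
          rw [← ofReal_integral_eq_lintegral_ofReal (hint n)]
          · exact ENNReal.ofReal_le_ofReal (hle n)
          · filter_upwards [hpos] with x hx
            by_cases hxS : x ∈ S n
            · simpa [hxS] using hx
            · simp [hxS]
  refine ⟨hneg, hzero, ⟨hm.aestronglyMeasurable, ?_⟩, ?_⟩
  · rw [hasFiniteIntegral_iff_ofReal hpos]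
    exact hlint.trans_lt ENNReal.ofReal_lt_top
  · rw [integral_eq_lintegral_of_nonneg_ae hpos hm.aestronglyMeasurable]
    exact ENNReal.toReal_le_of_le_ofReal hC₀ hlint

/-- The conclusion of `sq_div_of_forall_measurable` from smooth `φ` alone, and without
measurability of `P` and `B` beyond integrability. -/
theorem sq_div_of_forall_contDiff {P B : ℝ → ℝ}
    (hP : Integrable P) (hB : Integrable B) {C₀ : ℝ}
    (H : ∀ φ : ℝ → ℝ, ContDiff ℝ ((⊤ : ℕ∞) : WithTop ℕ∞) φ →
      0 ≤ C₀ + ∫ x, P x * φ x ^ 2 + B x * φ x) :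
    (∀ᵐ x, 0 ≤ P x) ∧ (∀ᵐ x, P x = 0 → B x = 0) ∧ Integrable (fun x => B x ^ 2 / (4 * P x)) ∧
      ∫ x, B x ^ 2 / (4 * P x) ≤ C₀ := by
  have eP := hP.1.aemeasurable.ae_eq_mk
  have eB := hB.1.aemeasurable.ae_eq_mk
  obtain ⟨h1, h2, h3, h4⟩ := sq_div_of_forall_measurable (C₀ := C₀)
    hP.1.aemeasurable.measurable_mk hB.1.aemeasurable.measurable_mk (hP.congr eP) (hB.congr eB) (by
      rintro φ hφ ⟨C, hC⟩
      have := nonneg_of_forall_contDiff hP hB H hφ hC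
      rwa [integral_congr_ae (g := fun x => hP.1.aemeasurable.mk P x * φ x ^ 2
        + hB.1.aemeasurable.mk B x * φ x)] at this
      filter_upwards [eP, eB] with x h1 h2
      rw [h1, h2])
  have e : (fun x => hB.1.aemeasurable.mk B x ^ 2 / (4 * hP.1.aemeasurable.mk P x)) =ᵐ[volume]
      fun x => B x ^ 2 / (4 * P x) := by
    filter_upwards [eP, eB] with x h1 h2
    rw [h1, h2]
  refine ⟨?_, ?_, h3.congr e, (integral_congr_ae e).symm.trans_le h4⟩
  · filter_upwards [eP, h1] with x h h'
    rwa [h]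
  · filter_upwards [eP, eB, h2] with x h h' h''
    rwa [h, h']

theorem exists_compact_exhaustion (I : Opens ℝ) : ∃ K : ℕ → Set ℝ, Monotone K ∧
    (∀ n, IsCompact (K n) ∧ K n ⊆ I) ∧ ∀ L, IsCompact L → L ⊆ I → ∃ n, L ⊆ K n := by
  have : LocallyCompactSpace I := I.isOpen.locallyCompactSpace
  let E := CompactExhaustion.choice I
  refine ⟨fun n => Subtype.val '' E n, fun m n h => image_mono (E.subset h),
    fun n => ⟨(E.isCompact n).image continuous_subtype_val, by
      rintro _ ⟨x, -, rfl⟩; exact x.2⟩, fun L hL hLI => ?_⟩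
  obtain ⟨n, hn⟩ := E.exists_superset_of_isCompact
    (Topology.IsInducing.subtypeVal.isCompact_preimage' hL (by simpa using hLI))
  exact ⟨n, fun x hx => ⟨⟨x, hLI hx⟩, hn hx, rfl⟩⟩

theorem ae_restrict_of_forall_compact {p : ℝ → Prop}
    (H : ∀ K, IsCompact K → K ⊆ I → ∀ᵐ x, x ∈ K → p x) :
    ∀ᵐ x ∂volume.restrict (I : Set ℝ), p x := by
  obtain ⟨K, -, hK, hKL⟩ := exists_compact_exhaustion I
  rw [ae_restrict_iff' I.isOpen.measurableSet]
  have := ae_all_iff.2 fun n => H (K n) (hK n).1 (hK n).2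
  filter_upwards [this] with x hx hxI
  obtain ⟨n, hn⟩ := hKL {x} isCompact_singleton (by simpa using hxI)
  exact hx n (hn rfl)

/-- Necessity of the criterion. For each `h`, `sq_div_of_forall_contDiff` applies to `P = p h²` and
`B = β h²`, where `B² / (4 P) = β² / (4 p) h²`. -/
theorem criterion_of_accretive {a b c : 𝓓'(I, ℂ)} {p β : ℝ → ℝ}
    (hp : LocallyIntegrableOn p I) (hpa : reD a = ofFun I p)
    (hβ : LocallyIntegrableOn β I) (hβb : imD b = ofFun I β) (hacc : IsAccretive a b c) :
    (∀ᵐ x ∂volume.restrict (I : Set ℝ), 0 ≤ p x) ∧ SqDivLocInt I β p ∧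
      ∀ h : 𝓓(I, ℝ), 0 ≤ (∫ x, p x * deriv h x ^ 2) - sigma b c (mul h h)
            - ∫ x, β x ^ 2 / (4 * p x) * h x ^ 2 := by
  have key : ∀ h : 𝓓(I, ℝ), (∀ᵐ x, 0 ≤ p x * h x ^ 2) ∧
      (∀ᵐ x, p x * h x ^ 2 = 0 → β x * h x ^ 2 = 0) ∧
      Integrable (fun x => β x ^ 2 / (4 * p x) * h x ^ 2) ∧
      ∫ x, β x ^ 2 / (4 * p x) * h x ^ 2 ≤
        (∫ x, p x * deriv h x ^ 2) - sigma b c (mul h h) := by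
    intro h
    have hP : Integrable (fun x => p x * h x ^ 2) := by
      have := integrable_test_mul hp (mul h h)
      refine this.congr (ae_of_all _ fun x => ?_)
      simp only [mul_apply]; ring
    have hB : Integrable (fun x => β x * h x ^ 2) := by
      have := integrable_test_mul hβ (mul h h)
      refine this.congr (ae_of_all _ fun x => ?_)
      simp only [mul_apply]; ring
    have e : (fun x => (β x * h x ^ 2) ^ 2 / (4 * (p x * h x ^ 2))) =
        fun x => β x ^ 2 / (4 * p x) * h x ^ 2 := by
      ext x
      rcases eq_or_ne (h x) 0 with h0 | h0
      · simp [h0]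
      · rcases eq_or_ne (p x) 0 with p0 | p0
        · simp [p0]
        · field_simp
    have := sq_div_of_forall_contDiff hP hB
      fun φ hφ => accretive_polar hp hpa hβ hβb hacc h hφ
    rwa [e] at this
  -- The local statements about `p` and `β` follow by taking `h = 1` on a given compact set.
  have hχ : ∀ K, IsCompact K → K ⊆ I → ∃ χ : 𝓓(I, ℝ), ∀ x ∈ K, χ x = 1 := fun K hK hKI => by
    obtain ⟨χ, -, h1⟩ := exists_cutoff hK hKI
    exact ⟨χ, fun x hx => (h1 x hx).self_of_nhds⟩
  refine ⟨ae_restrict_of_forall_compact fun K hK hKI => ?_,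
    ⟨ae_restrict_of_forall_compact fun K hK hKI => ?_, ?_⟩, fun h => ?_⟩
  · obtain ⟨χ, h1⟩ := hχ K hK hKI
    filter_upwards [(key χ).1] with x hx hxK
    simpa [h1 x hxK] using hx
  · obtain ⟨χ, h1⟩ := hχ K hK hKI
    filter_upwards [(key χ).2.1] with x hx hxK
    simpa [h1 x hxK] using hx
  · refine (locallyIntegrableOn_iff I.isOpen.isLocallyClosed).2 fun K hKI hK => ?_
    obtain ⟨χ, h1⟩ := hχ K hK hKI
    refine ((key χ).2.2.1.const_mul 4).integrableOn.congr_fun (fun x hx => ?_) hK.measurableSet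
    simp only [h1 x hx]
    rcases eq_or_ne (p x) 0 with p0 | p0
    · simp [p0]
    · field_simp
  · linarith [(key h).2.2.2]

/-! ### The criterion and the Riccati inequality imply accretivity -/

theorem deriv_eq_zero_of_notMem {F : Type*} [NormedAddCommGroup F] [NormedSpace ℝ F]
    (u : 𝓓(I, F)) {x : ℝ} (hx : x ∉ tsupport u) : deriv u x = 0 := by
  by_contra h
  exact hx (support_deriv_subset h)

theorem locallyIntegrableOn_sq_div_four {β p : ℝ → ℝ} (h : SqDivLocInt I β p) :
    LocallyIntegrableOn (fun x => β x ^ 2 / (4 * p x)) I := by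
  refine (locallyIntegrableOn_iff I.isOpen.isLocallyClosed).2 fun K hKI hK => ?_
  refine ((h.2.integrableOn_compact_subset hKI hK).const_mul (1 / 4)).congr
    (ae_of_all _ fun x => ?_)
  simp only
  rw [mul_comm 4, ← div_div]
  ring

theorem integrable_mul_deriv_sq {p : ℝ → ℝ} (hp : LocallyIntegrableOn p I) (h : 𝓓(I, ℝ)) :
    Integrable (fun x => p x * deriv h x ^ 2) := by
  have := integrable_test_mul hp (mul (∂_{(1 : ℝ)} h) (∂_{(1 : ℝ)} h))
  refine this.congr (ae_of_all _ fun x => ?_)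
  simp only [mul_apply, lineDeriv_one_apply]; ring

theorem integrable_mul_sq {q : ℝ → ℝ} (hq : LocallyIntegrableOn q I) (h : 𝓓(I, ℝ)) :
    Integrable (fun x => q x * h x ^ 2) := by
  have := integrable_test_mul hq (mul h h)
  refine this.congr (ae_of_all _ fun x => ?_)
  simp only [mul_apply]; ring

theorem deriv_eq_zero_of_eq_zero {h : 𝓓(I, ℝ)} (h0 : ∀ x, 0 ≤ h x) {x : ℝ} (hx : h x = 0) :
    deriv h x = 0 :=
  IsLocalMin.deriv_eq_zero (Eventually.of_forall fun y => by rw [hx]; exact h0 y)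

theorem mul_deriv_eq_of_sq_eq {v : 𝓓(I, ℂ)} {h : 𝓓(I, ℝ)} (hv : mul h h = normSqT v) (x : ℝ) :
    h x * deriv h x = (deriv v x * (starRingEnd ℂ) (v x)).re := by
  have h1 := congrArg (fun u => u x) (rePart_mul_conj_deriv v)
  simp only [rePart_apply, mul_apply, conj_apply, lineDeriv_one_apply, smul_apply] at h1
  rw [h1, ← hv]
  have h2 : HasDerivAt h (deriv h x) x := by
    simpa [lineDeriv_one_apply] using hasDerivAt_test h x
  have h3 : deriv (mul h h) x = deriv h x * h x + h x * deriv h x := (h2.mul h2).deriv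
  rw [h3, smul_eq_mul]
  ring

/-- The inequality of accretivity for a `v` whose modulus `h = |v|` is smooth. Pointwise
`p |v'|² + β Im (v' v̄) ≥ p h'² - β² / (4 p) h²`: with `z = v' v̄` one has `Re z = h h'` and
`h² |v'|² = (Re z)² + (Im z)²`, and `h²` times the difference of the two sides is
`(p Im z + β h² / 2)² / p`. -/
theorem nonneg_of_smooth_modulus {a b c : 𝓓'(I, ℂ)} {p β : ℝ → ℝ}
    (hp : LocallyIntegrableOn p I) (hpa : reD a = ofFun I p)
    (hβ : LocallyIntegrableOn β I) (hβb : imD b = ofFun I β)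
    (hp0 : ∀ᵐ x ∂volume.restrict (I : Set ℝ), 0 ≤ p x) (hβp : SqDivLocInt I β p)
    {v : 𝓓(I, ℂ)} {h : 𝓓(I, ℝ)} (hh0 : ∀ x, 0 ≤ h x) (hv : mul h h = normSqT v)
    (hcrit : 0 ≤ (∫ x, p x * deriv h x ^ 2) - sigma b c (mul h h)
            - ∫ x, β x ^ 2 / (4 * p x) * h x ^ 2) :
    0 ≤ (-form a b c v v).re := by
  rw [re_neg_form hp hpa hβ hβb, ← hv]
  have i1 : Integrable (fun x => p x * Complex.normSq (deriv v x)) := by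
    refine (integrable_test_mul hp (normSqT (∂_{(1 : ℝ)} v))).congr (ae_of_all _ fun x => ?_)
    simp only [normSqT_apply, lineDeriv_one_apply, mul_comm]
  have i2 : Integrable (fun x => β x * (deriv v x * (starRingEnd ℂ) (v x)).im) := by
    refine (integrable_test_mul hβ (imPart (mul (∂_{(1 : ℝ)} v) (conj v)))).congr
      (ae_of_all _ fun x => ?_)
    simp only [imPart_apply, mul_apply, conj_apply, lineDeriv_one_apply, mul_comm]
  have i3 := integrable_mul_deriv_sq hp h
  have i4 := integrable_mul_sq (locallyIntegrableOn_sq_div_four hβp) h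
  have key : ∫ x, (p x * deriv h x ^ 2 - β x ^ 2 / (4 * p x) * h x ^ 2) ≤
      ∫ x, (p x * Complex.normSq (deriv v x)
        + β x * (deriv v x * (starRingEnd ℂ) (v x)).im) := by
    refine integral_mono_ae (i3.sub i4) (i1.add i2) ?_
    have hpI := (ae_restrict_iff' I.isOpen.measurableSet).1 hp0
    have hβI := (ae_restrict_iff' I.isOpen.measurableSet).1 hβp.1
    filter_upwards [hpI, hβI] with x hpx hβx
    by_cases hxI : x ∈ (I : Set ℝ)
    · replace hpx := hpx hxI
      replace hβx := hβx hxI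
      have hnv : h x ^ 2 = Complex.normSq (v x) := by
        rw [← normSqT_apply, ← hv, mul_apply, sq]
      have hre := mul_deriv_eq_of_sq_eq hv x
      set z := deriv v x * (starRingEnd ℂ) (v x) with hz
      have hzn : Complex.normSq (deriv v x) * h x ^ 2 = z.re ^ 2 + z.im ^ 2 := by
        rw [hnv, ← Complex.normSq_conj (v x), ← Complex.normSq_mul, Complex.normSq_apply]
        ring
      rcases eq_or_ne (h x) 0 with h0 | h0
      · have hv0 : v x = 0 := by
          rw [h0] at hnv
          exact Complex.normSq_eq_zero.1 (by rw [← hnv]; ring)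
        rw [deriv_eq_zero_of_eq_zero hh0 h0, h0, hz, hv0]
        have := mul_nonneg hpx (Complex.normSq_nonneg (deriv v x))
        simpa using this
      · rcases hpx.eq_or_lt with p0 | p0
        · simp [← p0, hβx p0.symm]
        · have hh : 0 < h x ^ 2 := by positivity
          have e : (p x * Complex.normSq (deriv v x) + β x * z.im
              - (p x * deriv h x ^ 2 - β x ^ 2 / (4 * p x) * h x ^ 2)) * h x ^ 2
              = (p x * z.im + β x / 2 * h x ^ 2) ^ 2 / p x := by
            have : (p x * Complex.normSq (deriv v x) + β x * z.im
              - (p x * deriv h x ^ 2 - β x ^ 2 / (4 * p x) * h x ^ 2)) * h x ^ 2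
              = p x * (Complex.normSq (deriv v x) * h x ^ 2) + β x * z.im * h x ^ 2
                - p x * (h x * deriv h x) ^ 2 + β x ^ 2 / (4 * p x) * h x ^ 4 := by ring
            rw [this, hzn, hre]
            field_simp
            ring
          have : 0 ≤ (p x * Complex.normSq (deriv v x) + β x * z.im
              - (p x * deriv h x ^ 2 - β x ^ 2 / (4 * p x) * h x ^ 2)) * h x ^ 2 := by
            rw [e]; positivity
          linarith [nonneg_of_mul_nonneg_left this hh]
    · have hxv : x ∉ tsupport v := fun h' => hxI (v.tsupport_subset h')
      have hxh : x ∉ tsupport h := fun h' => hxI (h.tsupport_subset h')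
      simp [deriv_eq_zero_of_notMem v hxv, deriv_eq_zero_of_notMem h hxh,
        image_eq_zero_of_notMem_tsupport hxh]
  rw [integral_sub i3 i4, integral_add i1 i2] at key
  linarith

theorem pair_add (T : 𝓓'(I, ℂ)) (φ ψ : 𝓓(I, ℂ)) : pair T (φ + ψ) = pair T φ + pair T ψ := by
  have h1 : rePart (φ + ψ) = rePart φ + rePart ψ := by ext; simp
  have h2 : imPart (φ + ψ) = imPart φ + imPart ψ := by ext; simp
  simp only [pair, h1, h2, map_add]
  ring

theorem pair_smul (T : 𝓓'(I, ℂ)) (r : ℝ) (φ : 𝓓(I, ℂ)) : pair T (r • φ) = r • pair T φ := by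
  have h1 : rePart (r • φ) = r • rePart φ := by ext; simp
  have h2 : imPart (r • φ) = r • imPart φ := by ext; simp
  simp only [pair, h1, h2, map_smul, smul_add, mul_smul_comm]

theorem mul_add' (u v w : 𝓓(I, ℂ)) : mul u (v + w) = mul u v + mul u w := by
  ext; simp [mul_add]

theorem add_mul' (u v w : 𝓓(I, ℂ)) : mul (u + v) w = mul u w + mul v w := by
  ext; simp [add_mul]

theorem mul_smul' (r : ℝ) (u v : 𝓓(I, ℂ)) : mul u (r • v) = r • mul u v := by
  ext; simp; ring

theorem smul_mul' (r : ℝ) (u v : 𝓓(I, ℂ)) : mul (r • u) v = r • mul u v := by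
  ext; simp; ring

theorem conj_add (u v : 𝓓(I, ℂ)) : conj (u + v) = conj u + conj v := map_add _ _ _

theorem conj_smul (r : ℝ) (u : 𝓓(I, ℂ)) : conj (r • u) = r • conj u := map_smul _ _ _

/-- The form as an `ℝ`-bilinear map. -/
noncomputable def formBilin (a b c : 𝓓'(I, ℂ)) : 𝓓(I, ℂ) →ₗ[ℝ] 𝓓(I, ℂ) →ₗ[ℝ] ℂ :=
  LinearMap.mk₂ ℝ (form a b c)
    (fun u v w => by
      simp only [form, LineDeriv.lineDerivOp_add, add_mul', pair_add]; ring)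
    (fun r u v => by
      simp only [form, LineDeriv.lineDerivOp_smul, smul_mul', pair_smul, smul_add, smul_neg])
    (fun u v w => by
      simp only [form, LineDeriv.lineDerivOp_add, conj_add, mul_add', pair_add]; ring)
    (fun r u v => by
      simp only [form, LineDeriv.lineDerivOp_smul, conj_smul, mul_smul', pair_smul, smul_add,
        smul_neg])

theorem formBilin_apply (a b c : 𝓓'(I, ℂ)) (u v : 𝓓(I, ℂ)) :
    formBilin a b c u v = form a b c u v := rfl

/-- The complex test function `w χ`. -/
noncomputable def scaled (χ : 𝓓(I, ℝ)) (w : ℂ) : 𝓓(I, ℂ) :=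
  TestFunction.postcompCLM (𝕜 := ℝ) (Complex.ofRealCLM.smulRight w : ℝ →L[ℝ] ℂ) χ

@[simp] theorem scaled_apply (χ : 𝓓(I, ℝ)) (w : ℂ) (x : ℝ) : scaled χ w x = χ x * w := rfl

theorem scaled_eq (χ : 𝓓(I, ℝ)) (w : ℂ) :
    scaled χ w = w.re • scaled χ 1 + w.im • scaled χ Complex.I := by
  ext x
  simp only [add_apply, smul_apply, scaled_apply]
  apply Complex.ext <;> simp [mul_comm]

theorem continuous_form_add_scaled (a b c : 𝓓'(I, ℂ)) (u : 𝓓(I, ℂ)) (χ : 𝓓(I, ℝ)) :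
    Continuous fun w : ℂ => (-form a b c (u + scaled χ w) (u + scaled χ w)).re := by
  have key : ∀ v₁ v₂ : 𝓓(I, ℂ), Continuous fun w : ℂ =>
      (-form a b c (u + (w.re • v₁ + w.im • v₂)) (u + (w.re • v₁ + w.im • v₂))).re := by
    intro v₁ v₂
    simp only [← formBilin_apply, map_add, map_smul, LinearMap.add_apply, LinearMap.smul_apply]
    fun_prop
  simpa only [← scaled_eq] using key (scaled χ 1) (scaled χ Complex.I)

/-- Sufficiency of the criterion. The modulus of `u` need not be smooth at the zeros of `u`, but
`|u + w χ|` is, for a cutoff `χ` equal to `1` near the support of `u` and `-w` outside the range of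
`u`. Such `w` are dense in `ℂ`, and the form at `u + w χ` is continuous in `w`. -/
theorem accretive_of_criterion {a b c : 𝓓'(I, ℂ)} {p β : ℝ → ℝ}
    (hp : LocallyIntegrableOn p I) (hpa : reD a = ofFun I p)
    (hβ : LocallyIntegrableOn β I) (hβb : imD b = ofFun I β)
    (hp0 : ∀ᵐ x ∂volume.restrict (I : Set ℝ), 0 ≤ p x) (hβp : SqDivLocInt I β p)
    (hcrit : ∀ h : 𝓓(I, ℝ), 0 ≤ (∫ x, p x * deriv h x ^ 2) - sigma b c (mul h h)
            - ∫ x, β x ^ 2 / (4 * p x) * h x ^ 2) :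
    IsAccretive a b c := by
  intro u
  obtain ⟨χ, hχ0, hχ1⟩ := exists_cutoff u.hasCompactSupport u.tsupport_subset
  have hd : Dense (range fun x => -u x)ᶜ :=
    ContDiff.dense_compl_range_of_finrank_lt_finrank
      ((u.contDiff.neg).of_le (by exact_mod_cast le_top)) (by simp)
  have hclosed : IsClosed {w : ℂ | 0 ≤ (-form a b c (u + scaled χ w) (u + scaled χ w)).re} :=
    isClosed_le continuous_const (continuous_form_add_scaled a b c u χ)
  have hsub : (range fun x => -u x)ᶜ ⊆
      {w : ℂ | 0 ≤ (-form a b c (u + scaled χ w) (u + scaled χ w)).re} := by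
    intro w hw
    obtain ⟨h, hh⟩ := exists_sq_eq (normSqT (u + scaled χ w)) fun x => by
      by_cases hx : x ∈ tsupport u
      · left
        rw [normSqT_apply, add_apply, scaled_apply, (hχ1 x hx).self_of_nhds]
        refine Complex.normSq_pos.2 fun h0 => hw ⟨x, ?_⟩
        simp only [Complex.ofReal_one, one_mul] at h0
        simp only
        linear_combination -h0
      · right
        refine ⟨fun y => ‖w‖ * χ y, (contDiff_const.mul χ.contDiff).contDiffAt, ?_⟩
        filter_upwards [(isClosed_tsupport u).isOpen_compl.mem_nhds hx] with y hy
        refine ⟨mul_nonneg (norm_nonneg _) (hχ0 y), ?_⟩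
        rw [normSqT_apply, add_apply, scaled_apply, image_eq_zero_of_notMem_tsupport hy, zero_add,
          Complex.normSq_mul, Complex.normSq_ofReal, Complex.normSq_eq_norm_sq]
        ring
    refine nonneg_of_smooth_modulus hp hpa hβ hβb hp0 hβp (fun x => (hh x).1) ?_ (hcrit h)
    ext x
    rw [mul_apply, ← (hh x).2, sq]
  have h0 : (0 : ℂ) ∈ {w : ℂ | 0 ≤ (-form a b c (u + scaled χ w) (u + scaled χ w)).re} := by
    rw [← hclosed.closure_eq]
    exact closure_mono hsub (hd 0)
  have e : u + scaled χ 0 = u := by ext x; simp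
  rwa [mem_ofPred_eq, e] at h0

/-- The Riccati inequality tested on `h²` yields the criterion, since
`p h'² + 2 f h h' + f² h² / p = (p h' + f h)² / p ≥ 0`. -/
theorem criterion_of_riccati {b c : 𝓓'(I, ℂ)} {p β f : ℝ → ℝ}
    (hp : LocallyIntegrableOn p I)
    (hp0 : ∀ᵐ x ∂volume.restrict (I : Set ℝ), 0 ≤ p x) (hβp : SqDivLocInt I β p)
    (hf : LocallyIntegrableOn f I) (hfp : SqDivLocInt I f p) (hR : RiccatiLE b c p β f)
    (h : 𝓓(I, ℝ)) : 0 ≤ (∫ x, p x * deriv h x ^ 2) - sigma b c (mul h h)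
            - ∫ x, β x ^ 2 / (4 * p x) * h x ^ 2 := by
  have h1 := hR (mul h h) (fun x => mul_self_nonneg _)
  have hd : ∂_{(1 : ℝ)} (mul h h) = (2 : ℝ) • mul h (∂_{(1 : ℝ)} h) := by
    ext x
    have h2 := hasDerivAt_test h x
    rw [lineDeriv_one_apply, show deriv (mul h h) x = _ from (h2.mul h2).deriv, smul_apply,
      mul_apply, smul_eq_mul]
    ring
  have h1' : sigma b c (mul h h) + ofFun I (fun x => β x ^ 2 / (4 * p x)) (mul h h) ≤
      - ofFun I f (∂_{(1 : ℝ)} (mul h h)) - ofFun I (fun x => f x ^ 2 / p x) (mul h h) := by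
    simpa [Distribution.lineDerivOp_apply_apply] using h1
  rw [ofFun_apply (locallyIntegrableOn_sq_div_four hβp), ofFun_apply hf, ofFun_apply hfp.2,
    hd] at h1'
  have i1 := integrable_mul_deriv_sq hp h
  have i2 := integrable_test_mul hf ((2 : ℝ) • mul h (∂_{(1 : ℝ)} h))
  have i3 := integrable_test_mul hfp.2 (mul h h)
  have hpos : 0 ≤ ∫ x, (p x * deriv h x ^ 2 + ((2 : ℝ) • mul h (∂_{(1 : ℝ)} h)) x * f x)
      + mul h h x * (f x ^ 2 / p x) := by
    refine integral_nonneg_of_ae ?_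
    have hpI := (ae_restrict_iff' I.isOpen.measurableSet).1 hp0
    have hfI := (ae_restrict_iff' I.isOpen.measurableSet).1 hfp.1
    filter_upwards [hpI, hfI] with x hpx hfx
    by_cases hxI : x ∈ (I : Set ℝ)
    · simp only [smul_apply, mul_apply, lineDeriv_one_apply, smul_eq_mul, Pi.zero_apply]
      rcases (hpx hxI).eq_or_lt with p0 | p0
      · simp [← p0, hfx hxI p0.symm]
      · have : p x * deriv h x ^ 2 + 2 * (h x * deriv h x) * f x + h x * h x * (f x ^ 2 / p x)
          = (p x * deriv h x + h x * f x) ^ 2 / p x := by field_simp; ring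
        rw [this]; positivity
    · have hxh : x ∉ tsupport h := fun h' => hxI (h.tsupport_subset h')
      simp [deriv_eq_zero_of_notMem h hxh, image_eq_zero_of_notMem_tsupport hxh]
  have i12 : Integrable fun x => p x * deriv h x ^ 2 + ((2 : ℝ) • mul h (∂_{(1 : ℝ)} h)) x * f x :=
    i1.add i2
  rw [integral_add i12 i3, integral_add i1 i2] at hpos
  have e : ∫ x, mul h h x * (β x ^ 2 / (4 * p x)) = ∫ x, β x ^ 2 / (4 * p x) * h x ^ 2 := by
    congr 1; ext x; rw [mul_apply]; ring
  rw [e] at h1'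
  linarith

/-! ### The energy inequality and its convexity -/

theorem hasDerivAt_deriv (h : 𝓓(I, ℝ)) (x : ℝ) : HasDerivAt h (deriv h x) x := by
  simpa [lineDeriv_one_apply] using hasDerivAt_test h x

theorem deriv_mul_self (h : 𝓓(I, ℝ)) (x : ℝ) : deriv (mul h h) x = 2 * (h x * deriv h x) := by
  rw [show deriv (mul h h) x = _ from ((hasDerivAt_deriv h x).mul (hasDerivAt_deriv h x)).deriv]
  ring

/-- If `τ(h²) ≤ ∫ p h'²` for all `h`, then `τ(φ) ≤ ∫ p φ'² / (4 φ)` for all `φ ≥ 0`, written with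
`φ' = -2 ψ φ`. The function `√φ` need not be smooth, so `h = √(φ + ε χ²)` is used and `ε → 0`. -/
theorem le_energy {τ : 𝓓'(I, ℝ)} {p : ℝ → ℝ} (hpm : Measurable p) {M : ℝ} (hp0 : ∀ x, 0 ≤ p x)
    (hpM : ∀ x, p x ≤ M) (H : ∀ h : 𝓓(I, ℝ), τ (mul h h) ≤ ∫ x, p x * deriv h x ^ 2)
    {φ : 𝓓(I, ℝ)} (hφ : ∀ x, 0 ≤ φ x) {ψ : ℝ → ℝ} (hψ : Integrable (fun x => ψ x ^ 2 * φ x))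
    (hφψ : ∀ᵐ x, deriv φ x + 2 * (ψ x * φ x) = 0) :
    τ φ ≤ ∫ x, p x * (ψ x ^ 2 * φ x) := by
  obtain ⟨χ, hχ0, hχ1⟩ := exists_cutoff φ.hasCompactSupport φ.tsupport_subset
  have hpl : LocallyIntegrableOn p I := by
    refine LocallyIntegrable.locallyIntegrableOn ?_ _
    refine (locallyIntegrable_const M).mono hpm.aestronglyMeasurable (ae_of_all _ fun x => ?_)
    rw [Real.norm_eq_abs, Real.norm_eq_abs, abs_of_nonneg (hp0 x)]
    exact (hpM x).trans (le_abs_self _)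
  have iψ : Integrable (fun x => p x * (ψ x ^ 2 * φ x)) :=
    hψ.bdd_mul hpm.aestronglyMeasurable (c := M) (ae_of_all _ fun x => by
      rw [Real.norm_eq_abs, abs_of_nonneg (hp0 x)]; exact hpM x)
  have iχ := integrable_mul_deriv_sq hpl χ
  have key : ∀ ε : ℝ, 0 < ε → τ φ + ε * τ (mul χ χ) ≤
      (∫ x, p x * (ψ x ^ 2 * φ x)) + ε * ∫ x, p x * deriv χ x ^ 2 := by
    intro ε hε
    obtain ⟨h, hh⟩ := exists_sq_eq (φ + ε • mul χ χ) fun x => by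
      by_cases hx : x ∈ tsupport φ
      · left
        rw [add_apply, smul_apply, mul_apply, (hχ1 x hx).self_of_nhds, smul_eq_mul]
        linarith [hφ x]
      · right
        refine ⟨fun y => √ε * χ y, (contDiff_const.mul χ.contDiff).contDiffAt, ?_⟩
        filter_upwards [(isClosed_tsupport φ).isOpen_compl.mem_nhds hx] with y hy
        refine ⟨mul_nonneg (Real.sqrt_nonneg _) (hχ0 y), ?_⟩
        rw [add_apply, smul_apply, mul_apply, image_eq_zero_of_notMem_tsupport hy, mul_pow,
          Real.sq_sqrt hε.le, smul_eq_mul]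
        ring
    have hhm : mul h h = φ + ε • mul χ χ := by
      ext x; rw [mul_apply, ← (hh x).2, sq]
    have h1 := H h
    rw [hhm, map_add, map_smul, smul_eq_mul] at h1
    refine h1.trans ?_
    rw [← integral_const_mul, ← integral_add iψ (iχ.const_mul ε)]
    refine integral_mono_ae (integrable_mul_deriv_sq hpl h) (iψ.add (iχ.const_mul ε)) ?_
    filter_upwards [hφψ] with x hx
    have e1 : h x ^ 2 = φ x + ε * χ x ^ 2 := by
      rw [(hh x).2, add_apply, smul_apply, mul_apply, smul_eq_mul]; ring
    have e2 : h x * deriv h x = -(ψ x * φ x) + ε * (χ x * deriv χ x) := by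
      have h2 : deriv (mul h h) x = deriv φ x + ε * deriv (mul χ χ) x := by
        rw [hhm]
        exact ((hasDerivAt_deriv φ x).add ((hasDerivAt_deriv (mul χ χ) x).const_smul ε)).deriv
      rw [deriv_mul_self, deriv_mul_self] at h2
      linarith
    have hle : deriv h x ^ 2 ≤ ψ x ^ 2 * φ x + ε * deriv χ x ^ 2 := by
      rcases eq_or_ne (h x) 0 with h0 | h0
      · rw [deriv_eq_zero_of_eq_zero (fun x => (hh x).1) h0]
        have := hφ x
        have h4 : 0 ≤ ψ x ^ 2 * φ x + ε * deriv χ x ^ 2 := by positivity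
        simpa using h4
      · have hpos : 0 < h x ^ 2 := by positivity
        refine le_of_mul_le_mul_right ?_ hpos
        have : deriv h x ^ 2 * h x ^ 2 = (-(ψ x * φ x) + ε * (χ x * deriv χ x)) ^ 2 := by
          rw [← e2]; ring
        rw [this, e1]
        have h3 : 0 ≤ ε * φ x * (ψ x * χ x + deriv χ x) ^ 2 := by
          have := hφ x
          positivity
        linarith
    have := mul_le_mul_of_nonneg_left hle (hp0 x)
    linarith
  set C := (∫ x, p x * deriv χ x ^ 2) - τ (mul χ χ) with hC
  refine le_of_forall_pos_le_add fun δ hδ => ?_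
  have h1 := key (δ / (|C| + 1)) (by positivity)
  have h2 : δ / (|C| + 1) * C ≤ δ := by
    rw [div_mul_eq_mul_div, div_le_iff₀ (by positivity)]
    nlinarith [le_abs_self C]
  have h3 : δ / (|C| + 1) * C = δ / (|C| + 1) * (∫ x, p x * deriv χ x ^ 2)
    - δ / (|C| + 1) * τ (mul χ χ) := by rw [hC]; ring
  linarith

/-- The real square integrable functions vanishing almost everywhere off a compact subset of `I`. -/
def compactL2 (I : Opens ℝ) : Submodule ℝ (Lp ℝ 2 (volume : Measure ℝ)) where
  carrier := {ξ | ∃ K : Set ℝ, IsCompact K ∧ K ⊆ I ∧ ∀ᵐ x, x ∉ K → ξ x = 0}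
  zero_mem' := ⟨∅, isCompact_empty, empty_subset _, by
    filter_upwards [Lp.coeFn_zero ℝ 2 (volume : Measure ℝ)] with x hx _
    exact hx⟩
  add_mem' := by
    rintro ξ η ⟨K, hK, hKI, hξ⟩ ⟨L, hL, hLI, hη⟩
    refine ⟨K ∪ L, hK.union hL, union_subset hKI hLI, ?_⟩
    filter_upwards [hξ, hη, Lp.coeFn_add ξ η] with x h1 h2 h3 hx
    rw [h3, Pi.add_apply, h1 fun h => hx (Or.inl h), h2 fun h => hx (Or.inr h), add_zero]
  smul_mem' := by
    rintro c ξ ⟨K, hK, hKI, hξ⟩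
    refine ⟨K, hK, hKI, ?_⟩
    filter_upwards [hξ, Lp.coeFn_smul c ξ] with x h1 h3 hx
    rw [h3, Pi.smul_apply, h1 hx, smul_zero]

/-- `ξ = φ' + 2 ψ φ` almost everywhere, with a test function `φ ≥ 0` and `ψ` of finite energy
`∫ ψ² φ`. The energy is jointly convex in `(ξ, φ)`, being `∫ (ξ - φ')² / (4 φ)`; the function `ψ`
replaces the quotient so that zeros of `φ` need no convention. -/
structure IsControl (ξ : ℝ → ℝ) (φ : 𝓓(I, ℝ)) (ψ : ℝ → ℝ) : Prop where
  nonneg : ∀ x, 0 ≤ φ x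
  meas : AEStronglyMeasurable ψ
  integrable : Integrable fun x => ψ x ^ 2 * φ x
  eq : ∀ᵐ x, ξ x = deriv φ x + 2 * (ψ x * φ x)

theorem deriv_add_apply (φ₁ φ₂ : 𝓓(I, ℝ)) (x : ℝ) :
    deriv (φ₁ + φ₂) x = deriv φ₁ x + deriv φ₂ x :=
  ((hasDerivAt_deriv φ₁ x).add (hasDerivAt_deriv φ₂ x)).deriv

theorem IsControl.exists_add {ξ₁ ξ₂ : ℝ → ℝ} {φ₁ φ₂ : 𝓓(I, ℝ)} {ψ₁ ψ₂ : ℝ → ℝ}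
    (h₁ : IsControl ξ₁ φ₁ ψ₁) (h₂ : IsControl ξ₂ φ₂ ψ₂) :
    ∃ ψ, IsControl (fun x => ξ₁ x + ξ₂ x) (φ₁ + φ₂) ψ ∧
      ∀ x, ψ x ^ 2 * (φ₁ + φ₂) x ≤ ψ₁ x ^ 2 * φ₁ x + ψ₂ x ^ 2 * φ₂ x := by
  -- the mean of `ψ₁` and `ψ₂` with weights `φ₁` and `φ₂`
  set ψ : ℝ → ℝ := fun x => (ψ₁ x * φ₁ x + ψ₂ x * φ₂ x) / (φ₁ x + φ₂ x) with hψ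
  have e1 : ∀ x, ψ x * (φ₁ x + φ₂ x) = ψ₁ x * φ₁ x + ψ₂ x * φ₂ x := fun x => by
    rcases eq_or_ne (φ₁ x + φ₂ x) 0 with h | h
    · have a := h₁.nonneg x
      have b := h₂.nonneg x
      rw [h, show φ₁ x = 0 by linarith, show φ₂ x = 0 by linarith]
      simp
    · exact div_mul_cancel₀ _ h
  have e2 : ∀ x, ψ x ^ 2 * (φ₁ + φ₂) x ≤ ψ₁ x ^ 2 * φ₁ x + ψ₂ x ^ 2 * φ₂ x := fun x => by
    rw [add_apply]
    have a := mul_nonneg (h₁.nonneg x) (sq_nonneg (ψ₁ x - ψ x))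
    have b := mul_nonneg (h₂.nonneg x) (sq_nonneg (ψ₂ x - ψ x))
    linear_combination a + b + 2 * ψ x * e1 x
  have hm : AEStronglyMeasurable ψ :=
    (((h₁.meas.mul φ₁.continuous.aestronglyMeasurable).add
      (h₂.meas.mul φ₂.continuous.aestronglyMeasurable)).aemeasurable.div
      (φ₁.continuous.add φ₂.continuous).aemeasurable).aestronglyMeasurable
  refine ⟨ψ, ⟨fun x => add_nonneg (h₁.nonneg x) (h₂.nonneg x), hm, ?_, ?_⟩, e2⟩
  · refine (h₁.integrable.add h₂.integrable).mono'
      ((hm.pow 2).mul (φ₁ + φ₂).continuous.aestronglyMeasurable) (ae_of_all _ fun x => ?_)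
    have h3 : 0 ≤ (φ₁ + φ₂) x := add_nonneg (h₁.nonneg x) (h₂.nonneg x)
    rw [Real.norm_of_nonneg (by positivity)]
    exact e2 x
  · filter_upwards [h₁.eq, h₂.eq] with x a b
    rw [deriv_add_apply, add_apply, e1, a, b]
    ring

/-- Every `ξ` vanishing off `K` is controlled with `φ = χ²`, at an energy bounded in terms of
`‖ξ‖²`. -/
theorem exists_control_cutoff {K : Set ℝ} {χ : 𝓓(I, ℝ)} (hχ : ∀ x ∈ K, ∀ᶠ y in 𝓝 x, χ y = 1)
    {ξ : ℝ → ℝ} (hξ : MemLp ξ 2) (hξK : ∀ᵐ x, x ∉ K → ξ x = 0) :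
    ∃ ψ, IsControl ξ (mul χ χ) ψ ∧
      ∀ᵐ x, ψ x ^ 2 * mul χ χ x ≤ ξ x ^ 2 / 4 + deriv χ x ^ 2 := by
  -- Where `χ = 0` the quotient is `0`; there `ξ` and `(χ²)'` vanish too.
  set ψ : ℝ → ℝ := fun x => (ξ x - 2 * (χ x * deriv χ x)) / (2 * (χ x * χ x)) with hψ
  have hχd : Continuous (deriv χ) := χ.contDiff.continuous_deriv (by simp)
  have hm : AEStronglyMeasurable ψ :=
    ((hξ.1.aemeasurable.sub (continuous_const.mul (χ.continuous.mul hχd)).aemeasurable).div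
      (continuous_const.mul (χ.continuous.mul χ.continuous)).aemeasurable).aestronglyMeasurable
  have hle : ∀ᵐ x, ψ x ^ 2 * mul χ χ x ≤ ξ x ^ 2 / 4 + deriv χ x ^ 2 := by
    filter_upwards [hξK] with x hx
    by_cases hxK : x ∈ K
    · have h1 := (hχ x hxK).self_of_nhds
      have h2 : deriv χ x = 0 := by
        have h3 : χ =ᶠ[𝓝 x] fun _ => 1 := hχ x hxK
        rw [h3.deriv_eq, deriv_const]
      simp only [hψ, mul_apply, h1, h2]
      apply le_of_eq; ring
    · simp only [hψ, mul_apply, hx hxK]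
      rcases eq_or_ne (χ x) 0 with h0 | h0
      · rw [h0]; simp; positivity
      · apply le_of_eq; field_simp; ring
  have hχ2 : Integrable fun x => deriv χ x ^ 2 := by
    simpa using integrable_mul_deriv_sq
      ((locallyIntegrable_const (1 : ℝ)).locallyIntegrableOn (I : Set ℝ)) χ
  refine ⟨ψ, ⟨fun x => mul_self_nonneg _, hm, ?_, ?_⟩, hle⟩
  · refine ((hξ.integrable_sq.div_const 4).add hχ2).mono'
      ((hm.pow 2).mul (mul χ χ).continuous.aestronglyMeasurable) ?_
    filter_upwards [hle] with x hx
    have h3 : 0 ≤ mul χ χ x := mul_self_nonneg _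
    rw [Real.norm_of_nonneg (by positivity)]
    exact hx
  · filter_upwards [hξK] with x hx
    rw [deriv_mul_self, mul_apply]
    rcases eq_or_ne (χ x) 0 with h0 | h0
    · have hxK : x ∉ K := fun h => by
        have := (hχ x h).self_of_nhds
        rw [h0] at this; exact zero_ne_one this
      rw [hx hxK, h0]; simp
    · simp only [hψ]; field_simp; ring

/-! ### The dual functional and its representation -/

theorem IsControl.integrable_mul {ξ : ℝ → ℝ} {φ : 𝓓(I, ℝ)} {ψ : ℝ → ℝ} (h : IsControl ξ φ ψ)
    {p : ℝ → ℝ} (hpm : Measurable p) {M : ℝ} (hp0 : ∀ x, 0 ≤ p x) (hpM : ∀ x, p x ≤ M) :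
    Integrable fun x => p x * (ψ x ^ 2 * φ x) :=
  h.integrable.bdd_mul hpm.aestronglyMeasurable (c := M) (ae_of_all _ fun x => by
    rw [Real.norm_eq_abs, abs_of_nonneg (hp0 x)]; exact hpM x)

/-- The convex cone of the pairs `(ξ, t)` such that `∫ p ψ² φ - τ(φ) ≤ t` for some `φ`, `ψ` with
`ξ = φ' + 2 ψ φ`. -/
def controlCone (τ : 𝓓'(I, ℝ)) {p : ℝ → ℝ} (hpm : Measurable p) {M : ℝ} (hp0 : ∀ x, 0 ≤ p x)
    (hpM : ∀ x, p x ≤ M) : PointedCone ℝ (compactL2 I × ℝ) where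
  carrier := {q | ∃ (φ : 𝓓(I, ℝ)) (ψ : ℝ → ℝ), IsControl (q.1 : Lp ℝ 2 (volume : Measure ℝ)) φ ψ ∧
    (∫ x, p x * (ψ x ^ 2 * φ x)) - τ φ ≤ q.2}
  zero_mem' := by
    refine ⟨0, fun _ => 0, ⟨fun x => le_rfl, aestronglyMeasurable_const, by simp,
      ae_of_all _ fun x => by simp⟩, by simp⟩
  add_mem' := by
    rintro ⟨ξ₁, t₁⟩ ⟨ξ₂, t₂⟩ ⟨φ₁, ψ₁, h₁, ht₁⟩ ⟨φ₂, ψ₂, h₂, ht₂⟩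
    obtain ⟨ψ, h, hle⟩ := h₁.exists_add h₂
    refine ⟨φ₁ + φ₂, ψ, ⟨h.nonneg, h.meas, h.integrable, ?_⟩, ?_⟩
    · filter_upwards [h.eq, Lp.coeFn_add (ξ₁ : Lp ℝ 2 (volume : Measure ℝ)) ξ₂] with x hx hx'
      exact hx'.trans hx
    · have h3 := integral_mono (h.integrable_mul hpm hp0 hpM)
        ((h₁.integrable_mul hpm hp0 hpM).add (h₂.integrable_mul hpm hp0 hpM)) fun x => by
          have := mul_le_mul_of_nonneg_left (hle x) (hp0 x)
          rwa [mul_add] at this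
      rw [integral_add' (h₁.integrable_mul hpm hp0 hpM) (h₂.integrable_mul hpm hp0 hpM)] at h3
      simp only [map_add, Prod.mk_add_mk] at *
      linarith
  smul_mem' := by
    rintro ⟨c, hc⟩ ⟨ξ, t⟩ ⟨φ, ψ, h, ht⟩
    refine ⟨c • φ, ψ, ⟨fun x => mul_nonneg hc (h.nonneg x), h.meas, ?_, ?_⟩, ?_⟩
    · refine (h.integrable.const_mul c).congr (ae_of_all _ fun x => ?_)
      simp only [smul_apply, smul_eq_mul]; ring
    · filter_upwards [h.eq, Lp.coeFn_smul c (ξ : Lp ℝ 2 (volume : Measure ℝ))] with x hx hx'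
      have hd : deriv (c • φ) x = c * deriv φ x := ((hasDerivAt_deriv φ x).const_smul c).deriv
      refine hx'.trans ?_
      rw [Pi.smul_apply, hx, hd, smul_apply, smul_eq_mul, smul_eq_mul]
      ring
    · have e : ∫ x, p x * (ψ x ^ 2 * (c • φ) x) = c * ∫ x, p x * (ψ x ^ 2 * φ x) := by
        rw [← integral_const_mul]
        congr 1; ext x
        rw [smul_apply, smul_eq_mul]; ring
      have := mul_le_mul_of_nonneg_left ht hc
      rw [e, map_smul, smul_eq_mul, ← mul_sub]
      exact this

theorem exists_control (ξ : compactL2 I) : ∃ (φ : 𝓓(I, ℝ)) (ψ : ℝ → ℝ),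
    IsControl (ξ : Lp ℝ 2 (volume : Measure ℝ)) φ ψ := by
  obtain ⟨K, hK, hKI, hξ⟩ := ξ.2
  obtain ⟨χ, -, hχ⟩ := exists_cutoff hK hKI
  obtain ⟨ψ, h, -⟩ := exists_control_cutoff hχ (Lp.memLp (ξ : Lp ℝ 2 (volume : Measure ℝ))) hξ
  exact ⟨_, ψ, h⟩

/-- The Riesz extension theorem for `controlCone` and the functional `(0, t) ↦ t`, which is
nonnegative on the cone by `le_energy`. -/
theorem exists_functional {τ : 𝓓'(I, ℝ)} {p : ℝ → ℝ} (hpm : Measurable p) {M : ℝ}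
    (hp0 : ∀ x, 0 ≤ p x) (hpM : ∀ x, p x ≤ M)
    (H : ∀ h : 𝓓(I, ℝ), τ (mul h h) ≤ ∫ x, p x * deriv h x ^ 2) :
    ∃ Λ : compactL2 I →ₗ[ℝ] ℝ, ∀ (ξ : compactL2 I) (φ : 𝓓(I, ℝ)) (ψ : ℝ → ℝ),
      IsControl (ξ : Lp ℝ 2 (volume : Measure ℝ)) φ ψ →
        Λ ξ ≤ (∫ x, p x * (ψ x ^ 2 * φ x)) - τ φ := by
  let f : (compactL2 I × ℝ) →ₗ.[ℝ] ℝ :=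
    ⟨Submodule.prod ⊥ ⊤, (LinearMap.snd ℝ (compactL2 I) ℝ).domRestrict _⟩
  obtain ⟨g, hgf, hg⟩ := riesz_extension (controlCone τ hpm hp0 hpM) f (by
    rintro ⟨⟨ξ, t⟩, hξ⟩ ⟨φ, ψ, h, ht⟩
    have hξ0 : ξ = 0 := hξ.1
    subst hξ0
    change 0 ≤ t
    refine le_trans ?_ ht
    refine sub_nonneg.2 (le_energy hpm hp0 hpM H h.nonneg h.integrable ?_)
    filter_upwards [h.eq, Lp.coeFn_zero ℝ 2 (volume : Measure ℝ)] with x h1 h2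
    exact h1.symm.trans h2) (by
    rintro ⟨ξ, r⟩
    obtain ⟨φ, ψ, h⟩ := exists_control ξ
    refine ⟨⟨(0, (∫ x, p x * (ψ x ^ 2 * φ x)) - τ φ - r), by simp [f]⟩, φ, ψ, ?_, ?_⟩
    · simpa using h
    · simp)
  refine ⟨-(g ∘ₗ LinearMap.inl ℝ _ _), fun ξ φ ψ h => ?_⟩
  set t := (∫ x, p x * (ψ x ^ 2 * φ x)) - τ φ with ht
  have h1 : 0 ≤ g (ξ, t) := hg _ ⟨φ, ψ, h, le_rfl⟩
  have h2 : g (0, t) = t := hgf ⟨(0, t), by simp [f]⟩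
  have h3 : g (ξ, t) = g (ξ, 0) + g (0, t) := by rw [← map_add]; simp
  change -g (ξ, 0) ≤ t
  linarith

theorem integral_sq_eq_norm_sq (g : Lp ℝ 2 (volume : Measure ℝ)) : ∫ x, g x ^ 2 = ‖g‖ ^ 2 := by
  rw [← real_inner_self_eq_norm_sq, L2.inner_def]
  congr 1; ext x
  rw [real_inner_self_eq_norm_sq, Real.norm_eq_abs, sq_abs]

/-- Multiplication by the indicator function of a measurable subset of a compact subset of `I`. -/
noncomputable def restrictL2 {A K : Set ℝ} (hA : MeasurableSet A) (hAK : A ⊆ K) (hK : IsCompact K)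
    (hKI : K ⊆ I) : Lp ℝ 2 (volume : Measure ℝ) →ₗ[ℝ] compactL2 I where
  toFun g := ⟨((Lp.memLp g).indicator hA).toLp, K, hK, hKI, by
    filter_upwards [((Lp.memLp g).indicator hA).coeFn_toLp] with x hx hxK
    rw [hx, indicator_of_notMem fun h => hxK (hAK h)]⟩
  map_add' g₁ g₂ := by
    ext
    filter_upwards [((Lp.memLp (g₁ + g₂)).indicator hA).coeFn_toLp,
      ((Lp.memLp g₁).indicator hA).coeFn_toLp, ((Lp.memLp g₂).indicator hA).coeFn_toLp,
      Lp.coeFn_add g₁ g₂, Lp.coeFn_add ((Lp.memLp g₁).indicator hA).toLp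
        ((Lp.memLp g₂).indicator hA).toLp] with x h1 h2 h3 h4 h5
    refine h1.trans (Eq.trans ?_ h5.symm)
    rw [Pi.add_apply, h2, h3]
    by_cases hx : x ∈ A
    · rw [indicator_of_mem hx, indicator_of_mem hx, indicator_of_mem hx, h4, Pi.add_apply]
    · simp [hx]
  map_smul' c g := by
    ext
    filter_upwards [((Lp.memLp (c • g)).indicator hA).coeFn_toLp,
      ((Lp.memLp g).indicator hA).coeFn_toLp, Lp.coeFn_smul c g,
      Lp.coeFn_smul c ((Lp.memLp g).indicator hA).toLp] with x h1 h2 h4 h5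
    refine h1.trans (Eq.trans ?_ h5.symm)
    rw [Pi.smul_apply, h2]
    by_cases hx : x ∈ A
    · rw [indicator_of_mem hx, indicator_of_mem hx, h4, Pi.smul_apply]
    · simp [hx]

theorem restrictL2_apply {A K : Set ℝ} (hA : MeasurableSet A) (hAK : A ⊆ K) (hK : IsCompact K)
    (hKI : K ⊆ I) (g : Lp ℝ 2 (volume : Measure ℝ)) :
    ((restrictL2 hA hAK hK hKI g : compactL2 I) : Lp ℝ 2 (volume : Measure ℝ)) =ᵐ[volume]
      A.indicator g :=
  ((Lp.memLp g).indicator hA).coeFn_toLp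

theorem abs_le_of_le_on_ball {E : Type*} [NormedAddCommGroup E] [NormedSpace ℝ E]
    (ℓ : E →ₗ[ℝ] ℝ) {C : ℝ} (hC : ∀ x, ‖x‖ ≤ 1 → ℓ x ≤ C) (x : E) : ‖ℓ x‖ ≤ C * ‖x‖ := by
  rcases eq_or_ne x 0 with rfl | hx
  · simp
  · have hn : 0 < ‖x‖ := norm_pos_iff.2 hx
    have h1 : ‖(‖x‖⁻¹ • x)‖ ≤ 1 := by
      rw [norm_smul, norm_inv, norm_norm, inv_mul_cancel₀ hn.ne']
    have h2 := hC _ h1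
    have h3 := hC (-(‖x‖⁻¹ • x)) (by rwa [norm_neg])
    rw [map_neg] at h3
    rw [map_smul, smul_eq_mul] at h2 h3
    rw [inv_mul_le_iff₀ hn] at h2
    have h4 : -ℓ x ≤ ‖x‖ * C := by
      rw [← inv_mul_le_iff₀ hn]; linarith
    rw [Real.norm_eq_abs, abs_le]
    constructor <;> linarith

/-- The control with `φ = χ²`, where `χ = 1` near `K`, bounds `Λ` on the square integrable functions
vanishing off `K`, so that the Riesz representation theorem applies there. -/
theorem exists_local_representative {τ : 𝓓'(I, ℝ)} {p : ℝ → ℝ} (hpm : Measurable p) {M : ℝ}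
    (hp0 : ∀ x, 0 ≤ p x) (hpM : ∀ x, p x ≤ M) {Λ : compactL2 I →ₗ[ℝ] ℝ}
    (hΛ : ∀ (ξ : compactL2 I) (φ : 𝓓(I, ℝ)) (ψ : ℝ → ℝ),
      IsControl (ξ : Lp ℝ 2 (volume : Measure ℝ)) φ ψ →
        Λ ξ ≤ (∫ x, p x * (ψ x ^ 2 * φ x)) - τ φ)
    {K : Set ℝ} (hK : IsCompact K) (hKI : K ⊆ I) :
    ∃ F : Lp ℝ 2 (volume : Measure ℝ), ∀ ξ : compactL2 I,
      (∀ᵐ x, x ∉ K → (ξ : Lp ℝ 2 (volume : Measure ℝ)) x = 0) →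
        Λ ξ = ∫ x, F x * (ξ : Lp ℝ 2 (volume : Measure ℝ)) x := by
  have hM : 0 ≤ M := (hp0 0).trans (hpM 0)
  obtain ⟨χ, -, hχ⟩ := exists_cutoff hK hKI
  set T := restrictL2 hK.measurableSet (Subset.refl K) hK hKI with hT
  have hTg := restrictL2_apply hK.measurableSet (Subset.refl K) hK hKI
  have hχ2 : Integrable fun x => deriv χ x ^ 2 := by
    simpa using integrable_mul_deriv_sq
      ((locallyIntegrable_const (1 : ℝ)).locallyIntegrableOn (I : Set ℝ)) χ
  have hbound : ∀ g : Lp ℝ 2 (volume : Measure ℝ), ‖g‖ ≤ 1 →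
      (Λ ∘ₗ T) g ≤ M * (1 / 4 + ∫ x, deriv χ x ^ 2) - τ (mul χ χ) := by
    intro g hg
    obtain ⟨ψ, h, hle⟩ := exists_control_cutoff hχ
      (Lp.memLp (T g : Lp ℝ 2 (volume : Measure ℝ))) (by
        filter_upwards [hTg g] with x hx hxK
        rw [hx, indicator_of_notMem hxK])
    refine (hΛ _ _ _ h).trans (sub_le_sub_right ?_ _)
    have hg2 : Integrable fun x => g x ^ 2 := (Lp.memLp g).integrable_sq
    have h1 : ∫ x, p x * (ψ x ^ 2 * mul χ χ x) ≤ ∫ x, M * (g x ^ 2 / 4 + deriv χ x ^ 2) := by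
      refine integral_mono_ae (h.integrable_mul hpm hp0 hpM)
        (((hg2.div_const 4).add hχ2).const_mul M) ?_
      filter_upwards [hle, hTg g] with x h1 h2
      have h3 : (T g : Lp ℝ 2 (volume : Measure ℝ)) x ^ 2 ≤ g x ^ 2 := by
        rw [h2]
        by_cases hx : x ∈ K
        · simp [hx]
        · simp [hx]; positivity
      have h4 : 0 ≤ mul χ χ x := mul_self_nonneg _
      exact mul_le_mul (hpM x) (by linarith) (by positivity) hM
    refine h1.trans ?_
    rw [integral_const_mul, integral_add (hg2.div_const 4) hχ2, integral_div,
      integral_sq_eq_norm_sq]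
    have : ‖g‖ ^ 2 ≤ 1 := pow_le_one₀ (norm_nonneg _) hg
    gcongr
  let ℓ : Lp ℝ 2 (volume : Measure ℝ) →L[ℝ] ℝ :=
    (Λ ∘ₗ T).mkContinuous _ (abs_le_of_le_on_ball _ hbound)
  refine ⟨(InnerProductSpace.toDual ℝ _).symm ℓ, fun ξ hξ => ?_⟩
  have e : T (ξ : Lp ℝ 2 (volume : Measure ℝ)) = ξ := by
    ext
    filter_upwards [hTg ξ, hξ] with x h1 h2
    rw [h1]
    by_cases hx : x ∈ K
    · simp [hx]
    · simp [hx, h2 hx]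
  have h1 : ℓ (ξ : Lp ℝ 2 (volume : Measure ℝ)) = Λ ξ := by
    change Λ (T _) = _
    rw [e]
  rw [← h1, ← InnerProductSpace.toDual_symm_apply, L2.inner_def]
  congr 1; ext x
  exact mul_comm _ _

/-- Functions representing `Λ` on the sets of a compact exhaustion agree where they overlap, and
glue to one function on `I`. -/
theorem exists_global_representative {Λ : compactL2 I →ₗ[ℝ] ℝ}
    (hΛ : ∀ K : Set ℝ, IsCompact K → K ⊆ I → ∃ F : Lp ℝ 2 (volume : Measure ℝ),
      ∀ ξ : compactL2 I, (∀ᵐ x, x ∉ K → (ξ : Lp ℝ 2 (volume : Measure ℝ)) x = 0) →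
        Λ ξ = ∫ x, F x * (ξ : Lp ℝ 2 (volume : Measure ℝ)) x) :
    ∃ f : ℝ → ℝ, ∀ K : Set ℝ, IsCompact K → K ⊆ I → MemLp (K.indicator f) 2 ∧
      ∀ ξ : compactL2 I, (∀ᵐ x, x ∉ K → (ξ : Lp ℝ 2 (volume : Measure ℝ)) x = 0) →
        Λ ξ = ∫ x, K.indicator f x * (ξ : Lp ℝ 2 (volume : Measure ℝ)) x := by
  obtain ⟨K, hmono, hK, hKL⟩ := exists_compact_exhaustion I
  choose F hF using fun n => hΛ (K n) (hK n).1 (hK n).2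
  have hcompat : ∀ n N, n ≤ N → ∀ᵐ x, x ∈ K n → F n x = F N x := by
    intro n N hnN
    set ξ := restrictL2 (hK n).1.measurableSet (Subset.refl _) (hK n).1 (hK n).2 (F n - F N) with hξ
    have hξx := restrictL2_apply (hK n).1.measurableSet (Subset.refl _) (hK n).1 (hK n).2
      (F n - F N)
    have h1 := hF n ξ (by
      filter_upwards [hξx] with x hx hxK
      rw [hx, indicator_of_notMem hxK])
    have h2 := hF N ξ (by
      filter_upwards [hξx] with x hx hxK
      rw [hx, indicator_of_notMem fun h => hxK (hmono hnN h)])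
    have i1 : ∀ G : Lp ℝ 2 (volume : Measure ℝ),
        Integrable fun x => G x * (ξ : Lp ℝ 2 (volume : Measure ℝ)) x := fun G =>
      (Lp.memLp G).integrable_mul (Lp.memLp _)
    have h3 : ∫ x, (ξ : Lp ℝ 2 (volume : Measure ℝ)) x ^ 2 = 0 := by
      have : ∫ x, (F n x * (ξ : Lp ℝ 2 (volume : Measure ℝ)) x
          - F N x * (ξ : Lp ℝ 2 (volume : Measure ℝ)) x) = 0 := by
        rw [integral_sub (i1 _) (i1 _), ← h1, ← h2, sub_self]
      rw [← this]
      refine integral_congr_ae ?_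
      filter_upwards [hξx, Lp.coeFn_sub (F n) (F N)] with x h1 h2
      rw [h1]
      by_cases hx : x ∈ K n
      · rw [indicator_of_mem hx, h2, Pi.sub_apply]; ring
      · simp [hx]
    have h4 := (integral_eq_zero_iff_of_nonneg (fun x => sq_nonneg _)
      (Lp.memLp (ξ : Lp ℝ 2 (volume : Measure ℝ))).integrable_sq).1 h3
    filter_upwards [hξx, Lp.coeFn_sub (F n) (F N), h4] with x h1 h2 h3 hx
    have h5 : (ξ : Lp ℝ 2 (volume : Measure ℝ)) x = 0 := by simpa using h3
    rw [h1, indicator_of_mem hx, h2, Pi.sub_apply] at h5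
    linarith
  let f : ℝ → ℝ := fun x => F (sInf {n | x ∈ K n}) x
  have hfF : ∀ N, ∀ᵐ x, x ∈ K N → f x = F N x := fun N => by
    filter_upwards [ae_all_iff.2 fun n => ae_all_iff.2 fun h : n ≤ N => hcompat n N h] with x hx hxN
    have hmem : sInf {n | x ∈ K n} ∈ {n | x ∈ K n} := Nat.sInf_mem ⟨N, hxN⟩
    exact hx _ (Nat.sInf_le hxN) hmem
  refine ⟨f, fun L hL hLI => ?_⟩
  obtain ⟨N, hN⟩ := hKL L hL hLI
  have hLf : L.indicator f =ᵐ[volume] L.indicator (F N) := by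
    filter_upwards [hfF N] with x hx
    by_cases hxL : x ∈ L
    · simp [hxL, hx (hN hxL)]
    · simp [hxL]
  refine ⟨((Lp.memLp (F N)).indicator hL.measurableSet).ae_eq hLf.symm, fun ξ hξ => ?_⟩
  rw [hF N ξ (by
    filter_upwards [hξ] with x hx hxN
    exact hx fun h => hxN (hN h))]
  refine integral_congr_ae ?_
  filter_upwards [hLf, hξ] with x h1 h2
  rw [h1]
  by_cases hxL : x ∈ L
  · simp [hxL]
  · simp [h2 hxL]

/-- The inequality `Λ ξ ≤ ∫ p ψ² φ - τ(φ)` for `ξ = φ' + 2 ψ φ`, with `Λ` represented by `f`, is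
`∫ f φ' + 2 ∫ f ψ φ ≤ ∫ p ψ² φ - τ(φ)`; the choice `ψ = f / p` is optimal and turns it into the
Riccati inequality. -/
theorem exists_riccati {τ : 𝓓'(I, ℝ)} {p : ℝ → ℝ} (hpm : Measurable p) {m M : ℝ} (hm : 0 < m)
    (hpm' : ∀ x, m ≤ p x) (hpM : ∀ x, p x ≤ M)
    (H : ∀ h : 𝓓(I, ℝ), τ (mul h h) ≤ ∫ x, p x * deriv h x ^ 2) :
    ∃ f : ℝ → ℝ, (∀ K : Set ℝ, IsCompact K → K ⊆ I → MemLp (K.indicator f) 2) ∧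
      ∀ φ : 𝓓(I, ℝ), (∀ x, 0 ≤ φ x) →
        τ φ ≤ -(∫ x, deriv φ x * f x) - ∫ x, φ x * (f x ^ 2 / p x) := by
  have hp0 : ∀ x, 0 ≤ p x := fun x => hm.le.trans (hpm' x)
  obtain ⟨Λ, hΛ⟩ := exists_functional hpm hp0 hpM H
  obtain ⟨f, hf⟩ := exists_global_representative (Λ := Λ) fun K hK hKI =>
    exists_local_representative hpm hp0 hpM hΛ hK hKI
  refine ⟨f, fun K hK hKI => (hf K hK hKI).1, fun φ hφ => ?_⟩
  set K := tsupport φ with hKdef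
  have hK : IsCompact K := φ.hasCompactSupport
  obtain ⟨hfK, hrep⟩ := hf K hK φ.tsupport_subset
  set F := K.indicator f with hF
  have hz : ∀ x ∉ K, φ x = 0 := fun x => image_eq_zero_of_notMem_tsupport
  have hz' : ∀ x ∉ K, deriv φ x = 0 := fun x => deriv_eq_zero_of_notMem φ
  have hd : Continuous (deriv φ) := φ.contDiff.continuous_deriv (by simp)
  obtain ⟨B, hB⟩ := φ.continuous.bounded_above_of_compact_support φ.hasCompactSupport
  have hB0 : 0 ≤ B := (norm_nonneg _).trans (hB 0)
  have hψm : AEStronglyMeasurable fun x => F x / p x :=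
    (hfK.1.aemeasurable.div hpm.aemeasurable).aestronglyMeasurable
  have hψ : MemLp (fun x => F x / p x) 2 :=
    (hfK.const_mul m⁻¹).mono hψm (ae_of_all _ fun x => by
      rw [norm_div, norm_mul, norm_inv, Real.norm_of_nonneg (hp0 x), Real.norm_of_nonneg hm.le,
        div_eq_inv_mul]
      exact mul_le_mul_of_nonneg_right (inv_anti₀ hm (hpm' x)) (norm_nonneg _))
  have hψφ : MemLp (fun x => F x / p x * φ x) 2 :=
    (hψ.const_mul B).mono (hψm.mul φ.continuous.aestronglyMeasurable) (ae_of_all _ fun x => by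
      rw [norm_mul, norm_mul, mul_comm, Real.norm_of_nonneg hB0]
      exact mul_le_mul_of_nonneg_right (hB x) (norm_nonneg _))
  have hd2 : MemLp (deriv φ) 2 :=
    hd.memLp_of_hasCompactSupport (HasCompactSupport.intro hK hz')
  have hξ : MemLp (fun x => deriv φ x + 2 * (F x / p x * φ x)) 2 := hd2.add (hψφ.const_mul 2)
  let ξ : compactL2 I := ⟨hξ.toLp, K, hK, φ.tsupport_subset, by
    filter_upwards [hξ.coeFn_toLp] with x hx hxK
    rw [hx, hz x hxK, hz' x hxK]; simp⟩
  have hξx : (ξ : Lp ℝ 2 (volume : Measure ℝ)) =ᵐ[volume]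
      fun x => deriv φ x + 2 * (F x / p x * φ x) := hξ.coeFn_toLp
  have hψ2 : Integrable fun x => (F x / p x) ^ 2 * φ x := by
    refine (hψ.integrable_mul hψφ).congr (ae_of_all _ fun x => ?_)
    simp only [Pi.mul_apply]; ring
  have h1 := hΛ ξ φ (fun x => F x / p x) ⟨hφ, hψm, hψ2, hξx⟩
  rw [hrep ξ (by
    filter_upwards [hξx] with x hx hxK
    rw [hx, hz x hxK, hz' x hxK]; simp)] at h1
  have i1 : Integrable fun x => deriv φ x * F x := hd2.integrable_mul hfK
  have i2 : Integrable fun x => φ x * (F x ^ 2 / p x) := by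
    refine (hfK.integrable_mul hψφ).congr (ae_of_all _ fun x => ?_)
    simp only [Pi.mul_apply]; ring
  have e1 : ∫ x, F x * (ξ : Lp ℝ 2 (volume : Measure ℝ)) x =
      (∫ x, deriv φ x * F x) + 2 * ∫ x, φ x * (F x ^ 2 / p x) := by
    rw [← integral_const_mul, ← integral_add i1 (i2.const_mul 2)]
    refine integral_congr_ae ?_
    filter_upwards [hξx] with x hx
    rw [hx]; ring
  have e2 : ∫ x, p x * ((F x / p x) ^ 2 * φ x) = ∫ x, φ x * (F x ^ 2 / p x) := by
    congr 1; ext x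
    have : p x ≠ 0 := (hm.trans_le (hpm' x)).ne'
    field_simp
  have e3 : ∫ x, deriv φ x * F x = ∫ x, deriv φ x * f x := by
    congr 1; ext x
    by_cases hx : x ∈ K
    · simp [hF, hx]
    · simp [hz' x hx]
  have e4 : ∫ x, φ x * (F x ^ 2 / p x) = ∫ x, φ x * (f x ^ 2 / p x) := by
    congr 1; ext x
    by_cases hx : x ∈ K
    · simp [hF, hx]
    · simp [hz x hx]
  rw [e1, e2, e3, e4] at h1
  linarith

/-! ### The converse for bounded coefficients -/

/-- A coefficient bounded almost everywhere on `I` may be replaced by a Borel function bounded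
everywhere on `ℝ`. -/
theorem exists_measurable_ae_eq_of_bounds {p : ℝ → ℝ} (hp : LocallyIntegrableOn p I) {m M : ℝ}
    (hmM : ∀ᵐ x ∂volume.restrict (I : Set ℝ), m ≤ p x ∧ p x ≤ M) :
    ∃ (p' : ℝ → ℝ) (M' : ℝ), Measurable p' ∧ (∀ x, m ≤ p' x) ∧ (∀ x, p' x ≤ M') ∧
      ∀ᵐ x, x ∈ (I : Set ℝ) → p' x = p x := by
  have hm := hp.aestronglyMeasurable.aemeasurable
  -- on an empty `I` nothing prevents `M < m`, hence the upper bound `max m M`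
  refine ⟨fun x => max m (min (max m M) (hm.mk p x)), max m M,
    measurable_const.max (measurable_const.min hm.measurable_mk), fun x => le_max_left _ _,
    fun x => max_le (le_max_left _ _) (min_le_left _ _), ?_⟩
  rw [← ae_restrict_iff' I.isOpen.measurableSet]
  filter_upwards [hmM, hm.ae_eq_mk] with x h1 h2
  rw [← h2, min_eq_right (h1.2.trans (le_max_right _ _)), max_eq_right h1.1]

theorem exists_riccatiLE {b c : 𝓓'(I, ℂ)} {p β : ℝ → ℝ} (hp : LocallyIntegrableOn p I)
    (hβp : SqDivLocInt I β p) {m M : ℝ} (hm : 0 < m)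
    (hmM : ∀ᵐ x ∂volume.restrict (I : Set ℝ), m ≤ p x ∧ p x ≤ M)
    (hcrit : ∀ h : 𝓓(I, ℝ), 0 ≤ (∫ x, p x * deriv h x ^ 2) - sigma b c (mul h h)
            - ∫ x, β x ^ 2 / (4 * p x) * h x ^ 2) :
    ∃ f : ℝ → ℝ, LocL2 I f ∧ SqDivLocInt I f p ∧ RiccatiLE b c p β f := by
  obtain ⟨p', M', hp'm, hmp', hp'M, hpp'⟩ := exists_measurable_ae_eq_of_bounds hp hmM
  have hβ4 := locallyIntegrableOn_sq_div_four hβp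
  obtain ⟨f, hf2, hf⟩ := exists_riccati
    (τ := sigma b c + ofFun I (fun x => β x ^ 2 / (4 * p x))) hp'm hm hmp' hp'M fun h => by
      have e1 : ∫ x, p' x * deriv h x ^ 2 = ∫ x, p x * deriv h x ^ 2 := by
        refine integral_congr_ae ?_
        filter_upwards [hpp'] with x hx
        by_cases hxI : x ∈ (I : Set ℝ)
        · rw [hx hxI]
        · rw [deriv_eq_zero_of_notMem h fun h' => hxI (h.tsupport_subset h')]; simp
      have e2 : ofFun I (fun x => β x ^ 2 / (4 * p x)) (mul h h) =
          ∫ x, β x ^ 2 / (4 * p x) * h x ^ 2 := by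
        rw [ofFun_apply hβ4]
        congr 1; ext x; rw [mul_apply]; ring
      have := hcrit h
      rw [e1, add_apply, e2]
      linarith
  have hL2 : LocL2 I f := fun K hK hKI =>
    (memLp_indicator_iff_restrict hK.measurableSet).1 (hf2 K hK hKI)
  have hfl : LocallyIntegrableOn f I :=
    (locallyIntegrableOn_iff I.isOpen.isLocallyClosed).2 fun K hKI hK => by
      have : IsFiniteMeasure (volume.restrict K) := ⟨by
        rw [Measure.restrict_apply_univ]; exact hK.measure_lt_top⟩
      exact (hL2 K hK hKI).integrable (by norm_num)
  have hfp : LocallyIntegrableOn (fun x => f x ^ 2 / p x) I :=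
    (locallyIntegrableOn_iff I.isOpen.isLocallyClosed).2 fun K hKI hK => by
      have hm2 := hL2 K hK hKI
      refine (hm2.integrable_sq.const_mul m⁻¹).mono' ?_ ?_
      · exact ((hm2.1.aemeasurable.pow_const 2).div
          (hp.integrableOn_compact_subset hKI hK).1.aemeasurable).aestronglyMeasurable
      · filter_upwards [ae_restrict_of_ae_restrict_of_subset hKI hmM] with x hx
        have hpx : 0 < p x := hm.trans_le hx.1
        rw [Real.norm_of_nonneg (by positivity), div_eq_inv_mul]
        exact mul_le_mul_of_nonneg_right (inv_anti₀ hm hx.1) (sq_nonneg _)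
  refine ⟨f, hL2, ⟨?_, hfp⟩, fun φ hφ => ?_⟩
  · filter_upwards [hmM] with x hx h0
    linarith [hx.1]
  · have e1 : ∫ x, φ x * (f x ^ 2 / p' x) = ∫ x, φ x * (f x ^ 2 / p x) := by
      refine integral_congr_ae ?_
      filter_upwards [hpp'] with x hx
      by_cases hxI : x ∈ (I : Set ℝ)
      · rw [hx hxI]
      · rw [image_eq_zero_of_notMem_tsupport fun h' => hxI (φ.tsupport_subset h')]; simp
    have := hf φ hφ
    rw [e1] at this
    refine this.trans_eq ?_
    rw [sub_apply, Distribution.lineDerivOp_apply_apply, map_neg, ofFun_apply hfl, ofFun_apply hfp]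
    simp only [lineDeriv_one_apply]

theorem criterion_setIntegral_eq {b c : 𝓓'(I, ℂ)} (p β : ℝ → ℝ) (h : 𝓓(I, ℝ)) :
    (∫ x in (I : Set ℝ), p x * deriv h x ^ 2) - sigma b c (mul h h)
        - ∫ x in (I : Set ℝ), β x ^ 2 / (4 * p x) * h x ^ 2 =
      (∫ x, p x * deriv h x ^ 2) - sigma b c (mul h h)
        - ∫ x, β x ^ 2 / (4 * p x) * h x ^ 2 := by
  rw [setIntegral_eq_integral_of_forall_compl_eq_zero fun x hx => by
      rw [deriv_eq_zero_of_notMem h fun h' => hx (h.tsupport_subset h')]; simp,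
    setIntegral_eq_integral_of_forall_compl_eq_zero fun x hx => by
      rw [image_eq_zero_of_notMem_tsupport fun h' => hx (h.tsupport_subset h')]; simp]

end

end Accretive

open Accretive in
theorem theorem2p4 (I : Opens ℝ) (hI : (I : Set ℝ).OrdConnected)
    (a b c : 𝓓'(I, ℂ)) (p β : ℝ → ℝ)
    (hp : LocallyIntegrableOn p I) (hpa : reD a = ofFun I p)
    (hβ : LocallyIntegrableOn β I) (hβb : imD b = ofFun I β) :
    -- (i) the criterion of accretivity
    (IsAccretive a b c ↔
      (∀ᵐ x ∂volume.restrict (I : Set ℝ), 0 ≤ p x) ∧ SqDivLocInt I β p ∧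
        ∀ h : 𝓓(I, ℝ),
          0 ≤ (∫ x in (I : Set ℝ), p x * deriv h x ^ 2) - sigma b c (mul h h)
            - ∫ x in (I : Set ℝ), β x ^ 2 / (4 * p x) * h x ^ 2) ∧
    -- (ii) sufficiency of the Riccati inequality
    ((∀ᵐ x ∂volume.restrict (I : Set ℝ), 0 ≤ p x) → SqDivLocInt I β p →
      (∃ f : ℝ → ℝ, LocallyIntegrableOn f I ∧ SqDivLocInt I f p ∧ RiccatiLE b c p β f) →
        IsAccretive a b c) ∧
    -- (ii) the converse, for coefficients bounded above and below
    (∀ m M : ℝ, 0 < m → 0 < M →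
      (∀ᵐ x ∂volume.restrict (I : Set ℝ), m ≤ p x ∧ p x ≤ M) → IsAccretive a b c →
        ∃ f : ℝ → ℝ, LocL2 I f ∧ SqDivLocInt I β p ∧ SqDivLocInt I f p ∧
          RiccatiLE b c p β f) := by
  simp only [criterion_setIntegral_eq]
  refine ⟨⟨fun h => criterion_of_accretive hp hpa hβ hβb h, fun ⟨hp0, hβp, h⟩ =>
    accretive_of_criterion hp hpa hβ hβb hp0 hβp h⟩, ?_, ?_⟩
  · rintro hp0 hβp ⟨f, hf, hfp, hR⟩
    exact accretive_of_criterion hp hpa hβ hβb hp0 hβp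
      (criterion_of_riccati hp hp0 hβp hf hfp hR)
  · intro m M hm _ hmM hacc
    obtain ⟨-, hβp, hcrit⟩ := criterion_of_accretive hp hpa hβ hβb hacc
    obtain ⟨f, hL2, hfp, hR⟩ := exists_riccatiLE hp hβp hm hmM hcrit
    exact ⟨f, hL2, hβp, hfp, hR⟩
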